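/- **Definitions.** A semiblock graph is a graph $\mathcal G$ whose vertices (semiblocks) are pairwise disjoint nonempty sets. A *(normal) round representation* is a pair $\Phi=\langle\mathcal B(\Phi),F_r\rangle$, where $\mathcal B(\Phi)=B_1,\dots,B_n$ is a finite circularly ordered family of pairwise disjoint nonempty sets (indices modulo $n$; orderings that differ by a rotation are identified) and $F_r:\mathcal B(\Phi)\to\mathcal B(\Phi)$ satisfies $F_r(B_i)\in[B_i,F_r(B_{i+1})]$ for all $i$, such that $B\to W$ and $W\to B$ never hold together, where $B\to W$ means $W\in(B,F_r(B)]$. The left far neighbor $F_l(B)$ is the unique $B_j$ with $B_j\to B$ or $B_j=B$, and with $B_{j-1}=B$ or $B_{j-1}\not\to B$. $\Phi$ *represents* (is a round representation of) $\mathcal G$ if $V(\mathcal G)=\mathcal B(\Phi)$ and $N[B]=[F_l(B),F_r(B)]$ for all $B$; $\mathcal G(\Phi)$ denotes the unique graph represented by $\Phi$ ($B,W$ are adjacent iff $B\to W$ or $W\to B$). Two semiblocks are indistinguishable if they have the same $F_l$ and the same $F_r$; two round representations are *equal* if one is obtained from the other by permuting indistinguishable semiblocks. The reverse $\Phi^{-1}$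 has the reversed ordering and the reversed relation $\to$. Let $\mathcal G(\Phi)$ be co-bipartite. A *co-contig pair* of $\Phi$ is a pair $\langle\mathcal X,\mathcal Y\rangle$ of (possibly empty) ranges of $\mathcal B(\Phi)$ forming a partition into two cliques of a co-component of $\mathcal G(\Phi)$ (a component of the complement); it describes the *co-contig* $\Phi|(\mathcal X\cup\mathcal Y)$, the representation induced by $\Phi$ on $\mathcal X\cup\mathcal Y$. A *natural ordering* of the co-contigs of $\Phi$ is an ordering $\langle\mathcal X_1,\mathcal X_{s+1}\rangle,\dots,\langle\mathcal X_s,\mathcal X_{2s}\rangle$ of its co-contig pairs, one for each co-component, together with the co-contigs they describe, such that, up to rotation, $\mathcal B(\Phi)=\mathcal X_1\bullet\cdots\bullet\mathcal X_{2s}$, and the empty ranges occupy their proper places, i.e. for $i<j$ all semiblocks satisfy $\mathcal X_i\to\mathcal X_j\to\mathcal X_{s+i}\to\mathcal X_{s+j}\to\mathcal X_i$ (this last condition restricts only pairs of universal semiblocks). A *natural permutation* of $\mathbb B=\langle\mathcal X_1,\mathcal X_{s+1}\rangle,\dots,\langle\mathcal X_s,\mathcal X_{2s}\rangle$ is an ordering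 $\mathbb W=\langle\mathcal Y_1,\mathcal Y_{s+1}\rangle,\dots,\langle\mathcal Y_s,\mathcal Y_{2s}\rangle$ with $\mathcal Y_i=\mathcal X_{w(i)}^{y(i)}$ for a permutation $w$ of $\{1,\dots,2s\}$ and a map $y:\{1,\dots,2s\}\to\{-1,1\}$ such that $w(s+i)=s+w(i)$ (modulo $2s$) and $y(s+i)=y(i)$ for $1\le i\le s$; here $\mathcal X^1=\mathcal X$, $\mathcal X^{-1}$ is the reverse of $\mathcal X$, and the $i$-th co-contig of $\mathbb W$ is the co-contig of $\mathbb B$ containing $\mathcal X_{w(i)}$, reversed if $y(i)=-1$. **Theorem.** Let $\Phi$ be a round representation of a co-bipartite graph and $\mathbb B$ a natural ordering of the co-contigs of $\Phi$. Then a round representation $\Gamma$ is a round representation of $\mathcal G(\Phi)$ if and only if some natural permutation of $\mathbb B$ is a natural ordering of (a round representation equal to) $\Gamma$. Moreover, every natural permutation of $\mathbb B$ is a natural ordering of some round representation of $\mathcal G(\Phi)$. -/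

import Mathlib

/-- A semiblock graph: a graph whose vertices are pairwise disjoint nonempty sets (semiblocks). -/
structure SemiblockGraph (α : Type*) where
  semiblocks : Set (Set α)
  nonempty : ∀ B ∈ semiblocks, B.Nonempty
  disjoint : semiblocks.PairwiseDisjoint id
  graph : SimpleGraph semiblocks

namespace SemiblockGraph

variable {α : Type*} (G : SemiblockGraph α)

/-- Adjacency of two semiblocks of `G`, as a relation on sets. -/
def Adj (B W : Set α) : Prop :=
  ∃ (hB : B ∈ G.semiblocks) (hW : W ∈ G.semiblocks), G.graph.Adj ⟨B, hB⟩ ⟨W, hW⟩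

/-- The closed neighborhood `N[B]` of a semiblock `B` of `G`. -/
def closedNbhd (B : Set α) : Set (Set α) := {W | W = B ∨ G.Adj B W}

/-- `G` is co-bipartite: its complement is bipartite (one side of a bipartition may be empty). -/
def IsCoBipartite : Prop := G.graphᶜ.IsBipartite

/-- `𝒞` is the set of semiblocks of a co-component of `G`, i.e. of a component of the
complement of `G`. -/
def IsCoComponent (𝒞 : Set (Set α)) : Prop :=
  ∃ C : G.graphᶜ.ConnectedComponent, 𝒞 = Subtype.val '' C.supp

/-- A family of semiblocks is a clique of `G`. -/
def IsCliqueFamily (𝒞 : Set (Set α)) : Prop := 𝒞.Pairwise G.Adj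

end SemiblockGraph

/-- `k` lies in the circular range `[i, j]` of `0, …, n - 1`; subtraction in `Fin n` is modulo
`n`, so `k - i` is the number of steps to the right that lead from `i` to `k`. -/
def InRange {n : ℕ} (i j k : Fin n) : Prop := k - i ≤ j - i

/-- A (normal) round representation: a circularly indexed family `B_0, …, B_{n-1}` of pairwise
disjoint nonempty sets, and a map `F_r`, given on indices, with
`F_r (B_i) ∈ [B_i, F_r (B_{i+1})]` for every `i`, such that `B_i → B_j` and `B_j → B_i` never
hold together, where `B_i → B_j` means `B_j ∈ (B_i, F_r (B_i)]`.
`finRotate n` is the successor `i ↦ i + 1` modulo `n`. -/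
structure RoundRep (α : Type*) where
  n : ℕ
  block : Fin n → Set α
  nonempty : ∀ i, (block i).Nonempty
  disjoint : Pairwise fun i j => Disjoint (block i) (block j)
  Fr : Fin n → Fin n
  round : ∀ i, InRange i (Fr (finRotate n i)) (Fr i)
  normal : ∀ i j, ¬ ((j ≠ i ∧ InRange i (Fr i) j) ∧ (i ≠ j ∧ InRange j (Fr j) i))

namespace RoundRep

variable {α : Type*} (Φ : RoundRep α)

/-- `B_i → B_j`, i.e. `B_j ∈ (B_i, F_r (B_i)]`. -/
def To (i j : Fin Φ.n) : Prop := j ≠ i ∧ InRange i (Φ.Fr i) j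

/-- The relation `→` on semiblocks. -/
def Arrow (B W : Set α) : Prop := ∃ i j, Φ.block i = B ∧ Φ.block j = W ∧ Φ.To i j

/-- `B_j` is the left far neighbor of `B_i`: `B_j → B_i` or `B_j = B_i`, while
`B_{j-1} = B_i` or not `B_{j-1} → B_i`. -/
def IsLeftFar (i j : Fin Φ.n) : Prop :=
  (Φ.To j i ∨ j = i) ∧
    ((finRotate Φ.n).symm j = i ∨ ¬ Φ.To ((finRotate Φ.n).symm j) i)

theorem sub_val_of_rotate {n : ℕ} (k i : Fin n) (h : k ≠ i) :
    (i - finRotate n k).val + 1 = (i - k).val := by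
  obtain _ | n := n
  · exact k.elim0
  rw [finRotate_apply, ← sub_sub]
  have h0 : i - k ≠ 0 := fun e => h (sub_eq_zero.mp e).symm
  have h1 := Fin.val_sub_one_of_ne_zero h0
  have h2 : (i - k).val ≠ 0 := fun e => h0 (Fin.ext e)
  omega

theorem to_rotate {k i : Fin Φ.n} (h : Φ.To k i) :
    finRotate Φ.n k = i ∨ Φ.To (finRotate Φ.n k) i := by
  by_cases hi : finRotate Φ.n k = i
  · exact Or.inl hi
  refine Or.inr ⟨Ne.symm hi, ?_⟩
  have h1 := sub_val_of_rotate k i h.1.symm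
  have hr : i - k ≤ Φ.Fr (finRotate Φ.n k) - k := le_trans h.2 (Φ.round k)
  have hne : k ≠ Φ.Fr (finRotate Φ.n k) := by
    intro e
    rw [Fin.le_def, ← e] at hr
    have : (k - k).val = 0 := by
      have := k.pos
      have : NeZero Φ.n := ⟨by omega⟩
      simp
    omega
  have h2 := sub_val_of_rotate k _ hne
  rw [Fin.le_def] at hr
  rw [InRange, Fin.le_def]
  omega

theorem to_of_le (i : Fin Φ.n) : ∀ (d : ℕ) (j k : Fin Φ.n), (i - j).val = (i - k).val + d →
    Φ.To j i → k ≠ i → Φ.To k i := by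
  have inj : ∀ j k : Fin Φ.n, (i - j).val = (i - k).val → j = k := by
    intro j k h
    have := k.pos
    have : NeZero Φ.n := ⟨by omega⟩
    exact sub_right_injective (Fin.ext h)
  intro d
  induction d with
  | zero =>
    intro j k h hj _
    rwa [← inj j k h]
  | succ d ih =>
    intro j k h hj hk
    have h1 := sub_val_of_rotate j i hj.1.symm
    rcases Φ.to_rotate hj with h2 | h2
    · exfalso
      apply hk
      apply inj
      rw [h2] at h1
      have h3 : (i - i).val = 0 := by
        have := i.pos
        have : NeZero Φ.n := ⟨by omega⟩
        simp
      omega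
    · exact ih _ k (by omega) h2 hk

theorem existsUnique_isLeftFar (i : Fin Φ.n) : ∃! j, Φ.IsLeftFar i j := by
  classical
  have hpos := i.pos
  have : NeZero Φ.n := ⟨by omega⟩
  have h0 : (i - i).val = 0 := by simp
  have step : ∀ j, (finRotate Φ.n).symm j ≠ i →
      (i - j).val + 1 = (i - (finRotate Φ.n).symm j).val := by
    intro j hj
    have := sub_val_of_rotate _ i hj
    rwa [Equiv.apply_symm_apply] at this
  have aux : ∀ j k, Φ.IsLeftFar i j → Φ.IsLeftFar i k → ¬ (i - j).val < (i - k).val := by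
    intro j k hj hk hlt
    have hki : Φ.To k i := by
      rcases hk.1 with h | h
      · exact h
      · rw [h, h0] at hlt
        omega
    have hp : (finRotate Φ.n).symm j ≠ i := by
      intro e
      have hji : j = finRotate Φ.n i := by rw [← e, Equiv.apply_symm_apply]
      by_cases hij : j = i
      · have hf : finRotate Φ.n i = i := by rw [← hji, hij]
        have hk1 : (i - k).val < Φ.n := (i - k).isLt
        have := sub_val_of_rotate k i hki.1.symm
        have hn : Φ.n = 1 := by
          by_contra hn
          have := i.isLt
          obtain ⟨m, hm⟩ : ∃ m, Φ.n = m + 2 := ⟨Φ.n - 2, by omega⟩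
          have key : ∀ (n : ℕ), n = m + 2 → ∀ i : Fin n, finRotate n i ≠ i := by
            rintro _ rfl i
            rw [finRotate_apply]
            simp
          exact key _ hm i hf
        omega
      · have hk1 : (i - k).val < Φ.n := (i - k).isLt
        have key : ∀ (n : ℕ) (i : Fin n), finRotate n i ≠ i →
            (i - finRotate n i).val + 1 = n := by
          intro n i hi
          obtain _ | n := n
          · exact i.elim0
          · rw [finRotate_apply]
            simp
        have := key _ i (by rwa [← hji])
        rw [← hji] at this
        omega
    have h1 := step j hp
    rcases hj.2 with h | h
    · exact hp h
    · exact h (Φ.to_of_le i ((i - k).val - (i - (finRotate Φ.n).symm j).val) k _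
        (by omega) hki hp)
  obtain ⟨j, hj, hmax⟩ := Finset.exists_max_image
    (Finset.univ.filter fun j => Φ.To j i ∨ j = i) (fun j => (i - j).val) ⟨i, by simp⟩
  have hj' : Φ.IsLeftFar i j := by
    refine ⟨by simpa using hj, ?_⟩
    by_contra hcon
    push Not at hcon
    have h1 := step j hcon.1
    have h2 := hmax ((finRotate Φ.n).symm j)
      (Finset.mem_filter.mpr ⟨Finset.mem_univ _, Or.inl hcon.2⟩)
    omega
  refine ⟨j, hj', fun k hk => ?_⟩
  have h1 := aux j k hj' hk
  have h2 := aux k j hk hj'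
  have h3 : i - k = i - j := Fin.ext (by omega)
  exact sub_right_injective h3

/-- The index of the left far neighbor `F_l (B_i)`. -/
noncomputable def Fl (i : Fin Φ.n) : Fin Φ.n := (Φ.existsUnique_isLeftFar i).choose

/-- The enumeration `B_0, …, B_{n-1}` as a list (meaningful up to rotation). -/
def order : List (Set α) := List.ofFn Φ.block

theorem block_injective : Function.Injective Φ.block := by
  intro i j h
  by_contra hij
  have hd : Disjoint (Φ.block i) (Φ.block j) := Φ.disjoint hij
  rw [h, disjoint_self] at hd
  exact (Φ.nonempty j).ne_empty hd

/-- `Φ` represents the semiblock graph `G`: the semiblocks of `Φ` are those of `G` and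
`N[B] = [F_l (B), F_r (B)]` for each of them. -/
def Represents (G : SemiblockGraph α) : Prop :=
  G.semiblocks = Set.range Φ.block ∧
    ∀ i, G.closedNbhd (Φ.block i) = Φ.block '' {k | InRange (Φ.Fl i) (Φ.Fr i) k}

/-- The round graph `𝒢(Φ)` represented by `Φ`: `B` and `W` are adjacent if and only if
`B → W` or `W → B`. -/
def graph : SemiblockGraph α where
  semiblocks := Set.range Φ.block
  nonempty := by
    rintro _ ⟨i, rfl⟩
    exact Φ.nonempty i
  disjoint := by
    rintro _ ⟨i, rfl⟩ _ ⟨j, rfl⟩ h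
    exact Φ.disjoint fun hij => h (by rw [hij])
  graph :=
    { Adj := fun B W => Φ.Arrow B W ∨ Φ.Arrow W B
      symm := ⟨fun _ _ h => h.symm⟩
      loopless := ⟨by
        rintro B (⟨i, j, hi, hj, h⟩ | ⟨i, j, hi, hj, h⟩) <;>
          exact h.1 (Φ.block_injective (hj.trans hi.symm))⟩ }

/-- Two semiblocks are indistinguishable when they have the same far neighbors. -/
def Indistinguishable (i j : Fin Φ.n) : Prop := Φ.Fl i = Φ.Fl j ∧ Φ.Fr i = Φ.Fr j

/-- The representation obtained by placing the semiblock `B_{σ i}` at position `i`. -/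
def permute (σ : Equiv.Perm (Fin Φ.n)) : RoundRep α where
  n := Φ.n
  block := Φ.block ∘ σ
  nonempty i := Φ.nonempty (σ i)
  disjoint _ _ h := Φ.disjoint fun e => h (σ.injective e)
  Fr := Φ.Fr
  round := Φ.round
  normal := Φ.normal

/-- `Ψ` is obtained from `Φ` by permuting indistinguishable semiblocks. -/
def Equal (Φ Ψ : RoundRep α) : Prop :=
  ∃ σ : Equiv.Perm (Fin Φ.n), (∀ i, Φ.Indistinguishable i (σ i)) ∧ Ψ = Φ.permute σ

/-- `X` is a (possibly empty) range of the circular ordering of `Φ`, listed from left to right: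
an initial part of a rotation of it. -/
def IsRange (X : List (Set α)) : Prop := ∃ T : List (Set α), (X ++ T) ~r Φ.order

/-- `⟨X, Y⟩` is a co-contig pair of `Φ`: `X` and `Y` are ranges that form a co-bipartition of
some co-component of `𝒢(Φ)`, i.e. a partition of it into two (possibly empty) cliques. -/
structure IsCoContigPair (X Y : List (Set α)) : Prop where
  left_range : Φ.IsRange X
  right_range : Φ.IsRange Y
  disj : X.Disjoint Y
  coComponent : Φ.graph.IsCoComponent {B | B ∈ X ∨ B ∈ Y}
  left_clique : Φ.graph.IsCliqueFamily {B | B ∈ X}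
  right_clique : Φ.graph.IsCliqueFamily {B | B ∈ Y}

end RoundRep

/-- An ordering `⟨X_1, X_{s+1}⟩, …, ⟨X_s, X_{2s}⟩` of (prospective) co-contigs. The index set
`{1, …, 2s}` is `Fin s ⊕ Fin s`, with `inl i` for `i` and `inr i` for `s + i`, so that adding `s`
modulo `2s` is `Sum.swap`. The `i`-th co-contig is the round representation whose circular
ordering is `X_i` followed by `X_{s+i}` and whose `→` relation is `arrow i`. -/
structure CoContigOrdering (α : Type*) where
  s : ℕ
  X : Fin s ⊕ Fin s → List (Set α)
  arrow : Fin s → Set α → Set α → Prop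

namespace CoContigOrdering

variable {α : Type*}

/-- `X_1 • ⋯ • X_s • X_{s+1} • ⋯ • X_{2s}`. -/
def concat (𝔹 : CoContigOrdering α) : List (Set α) :=
  (List.ofFn fun i => 𝔹.X (Sum.inl i)).flatten ++ (List.ofFn fun i => 𝔹.X (Sum.inr i)).flatten

/-- `L^{-1}` (the reverse of `L`) if `b` is true, and `L` otherwise. -/
def revList (b : Bool) (L : List (Set α)) : List (Set α) := if b then L.reverse else L

/-- The `→` relation of the reverse representation if `b` is true, and `R` itself otherwise. -/
def revArrow (b : Bool) (R : Set α → Set α → Prop) : Set α → Set α → Prop :=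
  fun B W => if b then R W B else R B W

/-- The position, among the `s` co-contigs, of the co-contig containing the `p`-th range. -/
def coContigIndex {s : ℕ} (p : Fin s ⊕ Fin s) : Fin s := Sum.elim id id p

/-- `𝕎` is the ordering with `s` co-contigs whose `p`-th range is `X_{w p}`, reversed if `y p`
is true, and whose `i`-th co-contig is the one of `𝔹` that contains `X_{w i}`, reversed if `y i`
is true. -/
def reorder (𝔹 : CoContigOrdering α) (w : Equiv.Perm (Fin 𝔹.s ⊕ Fin 𝔹.s))
    (y : Fin 𝔹.s ⊕ Fin 𝔹.s → Bool) : CoContigOrdering α where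
  s := 𝔹.s
  X p := revList (y p) (𝔹.X (w p))
  arrow i := revArrow (y (Sum.inl i)) (𝔹.arrow (coContigIndex (w (Sum.inl i))))

/-- `𝕎` is a natural permutation of `𝔹`: it arises from a permutation `w` of `{1, …, 2s}` and
a choice `y` of the ranges to be reversed, with `w (s + i) = s + w i` (modulo `2s`) and
`y (s + i) = y i`. -/
def IsNaturalPermutation (𝔹 𝕎 : CoContigOrdering α) : Prop :=
  ∃ (w : Equiv.Perm (Fin 𝔹.s ⊕ Fin 𝔹.s)) (y : Fin 𝔹.s ⊕ Fin 𝔹.s → Bool),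
    (∀ i, w (Sum.inr i) = (w (Sum.inl i)).swap) ∧ (∀ i, y (Sum.inr i) = y (Sum.inl i)) ∧
      𝕎 = 𝔹.reorder w y

end CoContigOrdering

/-- `𝔹` is a natural ordering of the co-contigs of `Φ`. Since `concat` lists every semiblock of
`Φ` exactly once, every co-component is described by exactly one of the pairs. -/
structure RoundRep.IsNaturalOrdering {α : Type*} (Φ : RoundRep α) (𝔹 : CoContigOrdering α) :
    Prop where
  /-- the `i`-th pair is a co-contig pair of `Φ` -/
  pair : ∀ i, Φ.IsCoContigPair (𝔹.X (Sum.inl i)) (𝔹.X (Sum.inr i))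
  /-- the `i`-th co-contig is the representation induced by `Φ` on `X_i ∪ X_{s+i}` -/
  induced : ∀ i B W, 𝔹.arrow i B W ↔
    (B ∈ 𝔹.X (Sum.inl i) ∨ B ∈ 𝔹.X (Sum.inr i)) ∧
      (W ∈ 𝔹.X (Sum.inl i) ∨ W ∈ 𝔹.X (Sum.inr i)) ∧ Φ.Arrow B W
  /-- the circular ordering of `Φ` is `X_1 • ⋯ • X_{2s}` -/
  concat : 𝔹.concat ~r Φ.order
  /-- the empty ranges occupy their proper places: `X_i → X_j → X_{s+i} → X_{s+j} → X_i` for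
  `i < j`. This is automatic unless the `i`-th and the `j`-th pair both consist of a universal
  semiblock, one of their ranges being empty. -/
  place : ∀ i j, i < j →
    (∀ B ∈ 𝔹.X (Sum.inl i), ∀ W ∈ 𝔹.X (Sum.inl j), Φ.Arrow B W) ∧
    (∀ B ∈ 𝔹.X (Sum.inl j), ∀ W ∈ 𝔹.X (Sum.inr i), Φ.Arrow B W) ∧
    (∀ B ∈ 𝔹.X (Sum.inr i), ∀ W ∈ 𝔹.X (Sum.inr j), Φ.Arrow B W) ∧
    (∀ B ∈ 𝔹.X (Sum.inr j), ∀ W ∈ 𝔹.X (Sum.inl i), Φ.Arrow B W)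

/-! Call two distinct semiblocks joined by `H` if they are not adjacent, and fix a two-colouring
`side` of the bipartite graph `H`. The `twist` of the arrow relation keeps arrows within a colour
and reverses those between colours. Semiblocks with arrows into, or out of, a common one are
adjacent; hence in the twist two joined elements lie on the same side of every element comparable
with both (`IncOrder`). For a suitable colouring the twist is even a partial order with
incomparability graph `H` (`RoundRel.exists_cut`), and the circle, suitably cut, lists the elements
of colour `true` increasingly and then those of colour `false` increasingly
(`RoundRep.exists_sidedOrder`). Conversely, untwisting a sided order gives a round representation
(`SidedOrder.twist_between`, `RoundRep.exists_roundRep`).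

It remains to compare the sided orders of one graph. A comparison between two components of `H`
cannot change along an edge of `H`, so the components are linearly ordered
(`Describes.lt_of_support`); on each of them the colouring is unique up to exchanging the colours.
These two freedoms are the permutation `w`. Inside a component the order is unique up to reversal,
which is the map `y`, except on pairs with equal `H`-neighborhoods (`IncOrder.agree_or_reverse`).
For the proof, split the comparable pairs into those on which two given orders agree and those on
which they disagree: no triangle has one pair in `H` and one of each kind, and connectedness then
lets only one kind occur among pairs with different neighborhoods (`RainbowFree.uniform`). Elements
with the same nonempty neighborhood are indistinguishable semiblocks, whence equality up to their
permutation.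

`Describes` states what a natural ordering says about the graph alone. Natural orderings have this
property, natural permutations preserve it (`Describes.reorder`), every ordering with it is realised
(`Describes.exists_roundRep`), and all representations of the graph arise from its natural
permutations (`Describes.exists_isNaturalOrdering`). -/

/-! ### Colourings of pairs without rainbow triangles. -/

/-- `lt` orients exactly the pairs of `S` that are not joined by `H`, and the elements joined by
`H` to an element `a` lie on the same side as `a` of every element comparable with both. -/
structure IncOrder {β : Type*} (S : Set β) (H lt : β → β → Prop) : Prop where
  mem : ∀ a b, lt a b → a ∈ S ∧ b ∈ S
  asymm : ∀ a b, lt a b → ¬ lt b a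
  tri : ∀ a b, a ∈ S → b ∈ S → a ≠ b → lt a b ∨ lt b a ∨ H a b
  symm : ∀ a b, H a b → H b a
  not_inc : ∀ a b, lt a b → ¬ H a b
  left : ∀ a b c, lt a b → H a c → lt c b ∨ H c b
  right : ∀ a b c, lt a b → H b c → lt a c ∨ H a c

/-- A partition of the pairs of `C` into `H`, `P` and `M` without rainbow triangles, where `H` is
bipartite. -/
structure RainbowFree {β : Type*} (C : Set β) (H P M : β → β → Prop) (side : β → Bool) :
    Prop where
  mem : ∀ a b, H a b → a ∈ C → b ∈ C
  H_symm : ∀ a b, H a b → H b a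
  P_symm : ∀ a b, P a b → P b a
  M_symm : ∀ a b, M a b → M b a
  cover : ∀ a b, a ∈ C → b ∈ C → a ≠ b → H a b ∨ P a b ∨ M a b
  P_mem : ∀ a b, P a b → a ∈ C ∧ b ∈ C ∧ a ≠ b
  M_mem : ∀ a b, M a b → a ∈ C ∧ b ∈ C ∧ a ≠ b
  HP : ∀ a b, H a b → ¬ P a b
  HM : ∀ a b, H a b → ¬ M a b
  PM : ∀ a b, P a b → ¬ M a b
  side : ∀ a b, H a b → side a ≠ side b
  rainbow : ∀ a b c, H a b → P b c → ¬ M c a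

/-- Two elements have the same `H`-neighborhood. -/
def SameNbhd {β : Type*} (H : β → β → Prop) (a b : β) : Prop := ∀ e, H a e ↔ H b e

namespace RainbowFree

variable {β : Type*} {C : Set β} {H P M : β → β → Prop} {side : β → Bool}

theorem swap (h : RainbowFree C H P M side) : RainbowFree C H M P side where
  mem := h.mem
  H_symm := h.H_symm
  P_symm := h.M_symm
  M_symm := h.P_symm
  cover a b ha hb hab := by have := h.cover a b ha hb hab; tauto
  P_mem := h.M_mem
  M_mem := h.P_mem
  HP := h.HM
  HM := h.HP
  PM a b h1 h2 := h.PM a b h2 h1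
  side := h.side
  rainbow a b c h1 h2 h3 := h.rainbow b a c (h.H_symm _ _ h1) (h.P_symm _ _ h3) (h.M_symm _ _ h2)

theorem triangleFree (h : RainbowFree C H P M side) {a b c : β} (h1 : H a b) (h2 : H b c) :
    ¬ H a c := by
  intro h3
  have := h.side _ _ h1
  have := h.side _ _ h2
  have := h.side _ _ h3
  cases ha : side a <;> cases hb : side b <;> cases hc : side c <;> simp_all

/-- The triangle `a b c` already has a pair in `H` and a pair in `P`, so its third pair cannot be in
`M`. -/
theorem not_right (h : RainbowFree C H P M side) {a b c : β} (h1 : H a b) (h2 : P b c)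
    (h3 : ¬ H a c) : P a c := by
  have h4 := h.rainbow a b c h1 h2
  have h5 := h.cover a c (h.mem _ _ (h.H_symm _ _ h1) (h.P_mem _ _ h2).1) (h.P_mem _ _ h2).2.1
  have h6 := h.M_symm a c
  by_cases hac : a = c
  · subst hac
    exact absurd h2 (h.HP _ _ (h.H_symm _ _ h1))
  · tauto

/-- The property of having a `P`-partner with a different neighborhood propagates along `H`. -/
theorem propagate (h : RainbowFree C H P M side) {v w : β} (hvw : H v w)
    (hv : ∃ a, P a v ∧ ¬ SameNbhd H a v) : ∃ a, P a w ∧ ¬ SameNbhd H a w := by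
  obtain ⟨a, ha, hn⟩ := hv
  have hS := h.H_symm
  by_cases haw : H a w
  -- A vertex `t` telling the neighborhoods of `a` and `v` apart is the new partner of `w`.
  · simp only [SameNbhd, not_forall] at hn
    obtain ⟨t, ht⟩ := hn
    have h0 := h.P_symm _ _ ha
    by_cases h1 : H a t
    · have h2 : ¬ H v t := by tauto
      have h3 : P t v := h.not_right (hS _ _ h1) ha (fun e => h2 (hS _ _ e))
      have h4 : P w t := h.not_right (hS _ _ hvw) (h.P_symm _ _ h3)
        (h.triangleFree (hS _ _ haw) h1)
      exact ⟨t, h.P_symm _ _ h4, fun e => h2 (hS _ _ ((e v).2 (hS _ _ hvw)))⟩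
    · have h2 : H v t := by tauto
      have h3 : P t a := h.not_right (hS _ _ h2) h0 (fun e => h1 (hS _ _ e))
      have h4 : P w t := h.not_right (hS _ _ haw) (h.P_symm _ _ h3)
        (h.triangleFree (hS _ _ hvw) h2)
      exact ⟨t, h.P_symm _ _ h4, fun e => h1 (hS _ _ ((e a).2 (hS _ _ haw)))⟩
  · have h1 : P w a := h.not_right (hS _ _ hvw) (h.P_symm _ _ ha) (fun e => haw (hS _ _ e))
    exact ⟨a, h.P_symm _ _ h1, fun e => h.HP _ _ ((e v).2 (hS _ _ hvw)) ha⟩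

theorem propagate_path (h : RainbowFree C H P M side) {v w : β}
    (hvw : Relation.ReflTransGen H v w) (hv : ∃ a, P a v ∧ ¬ SameNbhd H a v) :
    ∃ a, P a w ∧ ¬ SameNbhd H a w := by
  induction hvw with
  | refl => exact hv
  | tail _ hbc ih => exact h.propagate hbc ih

/-- A `P`-partner of `v` may be moved to distance two from `v`. -/
theorem exists_near (h : RainbowFree C H P M side) {a v : β} (hav : Relation.ReflTransGen H a v)
    (ha : P a v) (hn : ¬ SameNbhd H a v) : ∃ a' u, P a' v ∧ H a' u ∧ H u v ∧ ¬ SameNbhd H a' v := by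
  induction hav using Relation.ReflTransGen.head_induction_on with
  | refl => exact absurd rfl (h.P_mem _ _ ha).2.2
  | @head a b hab _ ih =>
    by_cases hb : H b v
    · exact ⟨a, b, ha, hab, hb, hn⟩
    -- The next vertex `b` inherits `P`, and its neighborhood differs from that of `v` because `a`
    -- belongs only to the former.
    · exact ih (h.not_right (h.H_symm _ _ hab) ha hb)
        fun e => h.HP _ _ (h.H_symm _ _ ((e a).1 (h.H_symm _ _ hab))) ha

/-- If `a`, `v`, `c` have a common neighbor and the pairs at `v` differ in kind, then the pair `a`, `c`
is not of the kind of `c`, `v`. -/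
theorem third_pair (h : RainbowFree C H P M side) {a v c u : β} (ha : P a v) (hc : M c v)
    (hau : H a u) (huv : H u v) (huc : H u c) (hn : ¬ SameNbhd H a v) : ¬ M a c := by
  have hS := h.H_symm
  have ha' := h.P_symm _ _ ha
  have hc' := h.M_symm _ _ hc
  -- A vertex `t` is joined to exactly one of `a` and `v`; following the triangles at `t` ends in a
  -- rainbow triangle or in a pair of both kinds.
  simp only [SameNbhd, not_forall] at hn
  obtain ⟨t, ht⟩ := hn
  intro hac
  have hac' := h.M_symm _ _ hac
  by_cases h1 : H a t
  · have h2 : ¬ H v t := by tauto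
    have h3 : P t v := h.not_right (hS _ _ h1) ha (fun e => h2 (hS _ _ e))
    have h4 : ¬ H t c := fun e => h.rainbow c t v (hS _ _ e) h3 hc'
    have h5 : P u t := h.not_right huv (h.P_symm _ _ h3) (h.triangleFree (hS _ _ hau) h1)
    have h6 : P c t := h.not_right (hS _ _ huc) h5 (fun e => h4 (hS _ _ e))
    exact h.rainbow a t c h1 (h.P_symm _ _ h6) hac'
  · have h2 : H v t := by tauto
    have h3 : P t a := h.not_right (hS _ _ h2) ha' (fun e => h1 (hS _ _ e))
    have h5 : P u t := h.not_right (hS _ _ hau) (h.P_symm _ _ h3)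
      (h.triangleFree huv h2)
    by_cases h4 : H c t
    · exact h.rainbow c t a h4 h3 hac
    · exact h.PM _ _ (h.not_right (hS _ _ huc) h5 h4)
        (h.M_symm _ _ (h.swap.not_right (hS _ _ h2) hc' fun e => h4 (hS _ _ e)))

/-- Both partners of `v` can be moved to distance two. If `a`, `v`, `c` share a neighbor, then
`third_pair` and its mirror image leave no kind for the pair `a`, `c`. Otherwise this pair is in `M`
through `u` and in `P` through `w`. -/
theorem not_both (h : RainbowFree C H P M side)
    (hconn : ∀ a b, a ∈ C → b ∈ C → Relation.ReflTransGen H a b) {a v c : β} (ha : P a v)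
    (hc : M c v) (han : ¬ SameNbhd H a v) (hcn : ¬ SameNbhd H c v) : False := by
  have hS := h.H_symm
  have hPv := h.P_mem _ _ ha
  have hMv := h.M_mem _ _ hc
  obtain ⟨a, u, ha, hau, huv, han⟩ := h.exists_near (hconn _ _ hPv.1 hPv.2.1) ha han
  obtain ⟨c, w, hc, hcw, hwv, hcn⟩ := h.swap.exists_near (hconn _ _ hMv.1 hMv.2.1) hc hcn
  have key : ∀ u, H a u → H u v → H u c → False := by
    intro u hau huv huc
    have h1 := h.third_pair ha hc hau huv huc han
    have h2 := h.swap.third_pair hc ha (hS _ _ huc) huv (hS _ _ hau) hcn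
    have hac : a ≠ c := by
      rintro rfl
      exact h.PM _ _ ha hc
    rcases h.cover a c (h.P_mem _ _ ha).1 (h.M_mem _ _ hc).1 hac with h3 | h3 | h3
    · exact h.triangleFree hau huc h3
    · exact h2 (h.P_symm _ _ h3)
    · exact h1 h3
  by_cases huc : H u c
  · exact key u hau huv huc
  by_cases hwa : H w a
  · exact key w (hS _ _ hwa) hwv (hS _ _ hcw)
  have h1 : M u c := h.swap.not_right huv (h.M_symm _ _ hc) huc
  have h2 : P w a := h.not_right hwv (h.P_symm _ _ ha) hwa
  -- The closed walk `a u v w c` would have odd length.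
  have hac : ¬ H a c := by
    intro e
    have := h.side _ _ hau
    have := h.side _ _ huv
    have := h.side _ _ hcw
    have := h.side _ _ hwv
    have := h.side _ _ e
    cases h1 : side a <;> cases h2 : side u <;> cases h3 : side v <;> cases h4 : side w <;>
      cases h5 : side c <;> simp_all
  have h3 : M a c := h.swap.not_right hau h1 hac
  have h4 : P c a := h.not_right hcw h2 fun e => hac (hS _ _ e)
  exact h.PM _ _ h4 (h.M_symm _ _ h3)

/-- A `P`-pair can be propagated along an `H`-path to an end of an `M`-pair, where `not_both`
applies. -/
theorem uniform (h : RainbowFree C H P M side)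
    (hconn : ∀ a b, a ∈ C → b ∈ C → Relation.ReflTransGen H a b) :
    (∀ a b, ¬ SameNbhd H a b → ¬ P a b) ∨ (∀ a b, ¬ SameNbhd H a b → ¬ M a b) := by
  by_contra hcon
  push Not at hcon
  obtain ⟨⟨a, v, hav, ha⟩, ⟨c, w, hcw, hc⟩⟩ := hcon
  obtain ⟨b, hb, hbn⟩ := h.propagate_path
    (hconn v w (h.P_mem _ _ ha).2.1 (h.M_mem _ _ hc).2.1) ⟨a, ha, hav⟩
  exact h.not_both hconn hb hc hbn hcw

end RainbowFree

/-! ### Twists, and uniqueness of orientations up to reversal. -/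

/-- The relation `R` with its arguments exchanged on pairs of elements of different sides. -/
def twist {β : Type*} (side : β → Bool) (R : β → β → Prop) (a b : β) : Prop :=
  (side a = side b ∧ R a b) ∨ (side a ≠ side b ∧ R b a)

theorem twist_twist {β : Type*} (side : β → Bool) (R : β → β → Prop) (a b : β) :
    twist side (twist side R) a b ↔ R a b := by
  unfold twist
  by_cases h : side a = side b
  · simp [h]
  · simp [h, Ne.symm h]

namespace IncOrder

variable {β : Type*} {S : Set β} {H lt lt' : β → β → Prop} {side : β → Bool}

theorem flip (h : IncOrder S H lt) : IncOrder S H (fun a b => lt b a) where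
  mem a b hab := (h.mem b a hab).symm
  asymm a b hab := h.asymm b a hab
  tri a b ha hb hab := by have := h.tri a b ha hb hab; tauto
  symm := h.symm
  not_inc a b hab e := h.not_inc b a hab (h.symm _ _ e)
  left a b c hab hac := (h.right b a c hab hac).imp_right (h.symm _ _)
  right a b c hab hac := (h.left b a c hab hac).imp_right (h.symm _ _)

theorem irrefl (h : IncOrder S H lt) (a : β) : ¬ lt a a := fun e => h.asymm _ _ e e

/-- Two orientations of the pairs not joined by a connected bipartite graph agree, or are reverse
to each other, on all pairs with different neighborhoods. -/
theorem agree_or_reverse (h : IncOrder S H lt) (h' : IncOrder S H lt')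
    (hmem : ∀ a b, H a b → a ∈ S → b ∈ S) (hside : ∀ a b, H a b → side a ≠ side b)
    (hconn : ∀ a b, a ∈ S → b ∈ S → Relation.ReflTransGen H a b) :
    (∀ a b, ¬ SameNbhd H a b → (lt a b ↔ lt' a b)) ∨
      (∀ a b, ¬ SameNbhd H a b → (lt a b ↔ lt' b a)) := by
  -- `P` collects the pairs oriented alike and `M` those oriented oppositely. Joined elements lie on
  -- one side of a third in both orientations, so no triangle is rainbow.
  have key : RainbowFree S H (fun a b => (lt a b ∧ lt' a b) ∨ (lt b a ∧ lt' b a))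
      (fun a b => (lt a b ∧ lt' b a) ∨ (lt b a ∧ lt' a b)) side := by
    obtain ⟨p1, p2, p3, p4, p5, p6, p7⟩ := h
    obtain ⟨q1, q2, q3, q4, q5, q6, q7⟩ := h'
    refine ⟨hmem, p4, ?_, ?_, ?_, ?_, ?_, ?_, ?_, ?_, hside, ?_⟩
    · grind
    · grind
    · grind
    · grind
    · grind
    · grind
    · grind
    · grind
    · rintro a b c hab (h1 | h1) (h2 | h2) <;> grind
  obtain ⟨p1, p2, p3, p4, p5, p6, p7⟩ := h
  obtain ⟨q1, q2, q3, q4, q5, q6, q7⟩ := h'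
  have hr : ∀ a b, ¬ SameNbhd H a b → a ≠ b := by
    rintro a b hab rfl
    exact hab fun _ => Iff.rfl
  rcases key.uniform hconn with hk | hk
  · refine Or.inr fun a b hab => ?_
    have := hk a b hab
    have := hr a b hab
    grind
  · refine Or.inl fun a b hab => ?_
    have := hk a b hab
    have := hr a b hab
    grind

end IncOrder

/-! ### Cutting a round relation into a partial order. -/

/-- The properties of the relation `→` of a round representation, with `H` its non-adjacency. -/
structure RoundRel {β : Type*} (S : Set β) (H R : β → β → Prop) : Prop where
  mem : ∀ a b, R a b → a ∈ S ∧ b ∈ S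
  inc_iff : ∀ a b, H a b ↔ a ∈ S ∧ b ∈ S ∧ a ≠ b ∧ ¬ R a b ∧ ¬ R b a
  asymm : ∀ a b, R a b → ¬ R b a
  into : ∀ a b c, R a c → R b c → ¬ H a b
  outOf : ∀ a b c, R a b → R a c → ¬ H b c
  cycle : ∀ a b c d, R a b → R b c → R c a → d ∈ S → d ≠ a → d ≠ b → d ≠ c →
    (R a d ∧ R d b) ∨ (R b d ∧ R d c) ∨ (R c d ∧ R d a)

/-- A transitive orientation of the non-edges of a properly colored graph `H` on `S`. -/
structure SidedOrder {β : Type*} (S : Set β) (H lt : β → β → Prop) (side : β → Bool) : Prop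
    extends IncOrder S H lt where
  inc_mem : ∀ a b, H a b → a ∈ S ∧ b ∈ S
  proper : ∀ a b, H a b → side a ≠ side b
  trans : ∀ a b c, lt a b → lt b c → lt a c

theorem bool_eq_of_ne {x y z : Bool} (h1 : x ≠ y) (h2 : z ≠ y) : x = z := by
  cases x <;> cases y <;> cases z <;> simp_all

namespace RoundRel

variable {β : Type*} {S : Set β} {H R : β → β → Prop} {side : β → Bool}

theorem inc_symm (h : RoundRel S H R) (a b : β) (hab : H a b) : H b a := by
  rw [h.inc_iff] at hab ⊢
  tauto

/-- If `a` and `c` are joined, `into` and `outOf` force their arrows with `b` to point in opposite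
directions relative to `b`. Exactly one of `a`, `c` has the colour of `b`, so the twist makes the
directions equal. -/
theorem incOrder_twist (h : RoundRel S H R) (hs : ∀ a b, H a b → side a ≠ side b) :
    IncOrder S H (twist side R) := by
  have hsymm := h.inc_symm
  obtain ⟨h1, h2, h3, h4, h5, h6⟩ := h
  refine ⟨?_, ?_, ?_, hsymm, ?_, ?_, ?_⟩ <;> unfold twist
  · grind
  · grind
  · grind
  · grind
  · intro a b c hab hac
    have hsc := hs _ _ hac
    by_cases hcb : c = b
    · grind
    have hc := h2 c b
    rcases hab with ⟨e, hab⟩ | ⟨e, hab⟩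
    · have hf := h4 a c b hab
      have e2 : ¬ side c = side b := e ▸ Ne.symm hsc
      grind
    · have hf := h5 b a c hab
      have e2 : side c = side b := bool_eq_of_ne (Ne.symm hsc) (Ne.symm e)
      grind
  · intro a b c hab hbc
    have hsc := hs _ _ hbc
    by_cases hcb : a = c
    · grind
    have hc := h2 a c
    rcases hab with ⟨e, hab⟩ | ⟨e, hab⟩
    · have hf := h5 a b c hab
      have e2 : ¬ side a = side c := e ▸ hsc
      grind
    · have hf := h4 b c a hab
      have e2 : side a = side c := bool_eq_of_ne e (Ne.symm hsc)
      grind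

/-- Along the path from `a` to `b`, the first vertex of the triangle is replaced by its successor
`d`, until the triangle degenerates to `b < b`. If `d` is joined to just one of `b`, `c`, asymmetry
fails. -/
theorem no_cycle (h : RoundRel S H R) (hs : ∀ a b, H a b → side a ≠ side b) {a b c : β}
    (hp : Relation.ReflTransGen H a b) (hab : twist side R a b) (hbc : twist side R b c)
    (hca : twist side R c a) : False := by
  have hI := h.incOrder_twist hs
  induction hp using Relation.ReflTransGen.head_induction_on with
  | refl => exact hI.irrefl _ hab
  | @head a d had _ ih =>
    have h1 := hI.left _ _ _ hab had
    have h2 := hI.right _ _ _ hca had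
    by_cases h3 : H d b
    · by_cases h4 : H c d
      -- Now `d` is joined to `a`, `b`, `c`, which thus have one colour. The cycle `a → b → c → a`
      -- goes around the circle, and `d` in one of its arcs would be adjacent to two of them.
      · have s1 := hs _ _ had
        have s2 := hs _ _ h3
        have s3 := hs _ _ h4
        rw [h.inc_iff] at had h3 h4
        have e1 : side a = side b := bool_eq_of_ne s1 (Ne.symm s2)
        have e2 : side b = side c := bool_eq_of_ne (Ne.symm s2) s3
        unfold twist at hab hbc hca
        have := h.cycle a b c d
        grind
      · have h5 : twist side R c d := h2.resolve_right h4
        have h6 := hI.left _ _ _ hbc (h.inc_symm _ _ h3)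
        have h7 := hI.asymm _ _ h5
        exact h6.elim h7 fun e => h4 (h.inc_symm _ _ e)
    · have h5 : twist side R d b := h1.resolve_right h3
      by_cases h4 : H c d
      · have h6 := hI.right _ _ _ hbc h4
        have h7 := hI.asymm _ _ h5
        exact h6.elim h7 fun e => h3 (h.inc_symm _ _ e)
      · exact ih h5 (h2.resolve_right h4)

/-- If `c` were joined to `a`, it would lie below `b` with `a`, or be joined to `b`. Transitivity is
not needed. -/
theorem not_inc_of_chain (h : IncOrder S H R) {a b c : β} (hab : R a b) (hbc : R b c) :
    ¬ H a c := by
  intro hac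
  have h1 := h.left _ _ _ hab hac
  exact h1.elim (h.asymm _ _ hbc) fun e => h.not_inc _ _ hbc (h.symm _ _ e)

theorem twist_trans_of_path (h : RoundRel S H R) (hs : ∀ a b, H a b → side a ≠ side b) {a b c : β}
    (hp : Relation.ReflTransGen H a b) (hab : twist side R a b) (hbc : twist side R b c) :
    twist side R a c := by
  have hI := h.incOrder_twist hs
  have h1 := not_inc_of_chain hI hab hbc
  have hac : a ≠ c := by
    rintro rfl
    exact hI.asymm _ _ hab hbc
  rcases hI.tri a c (hI.mem _ _ hab).1 (hI.mem _ _ hbc).2 hac with h2 | h2 | h2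
  · exact h2
  · exact (h.no_cycle hs hp hab hbc h2).elim
  · exact absurd h2 h1

/-- A round relation whose non-adjacency is bipartite can be cut into a sided order with a
minimal element on the first side. -/
theorem exists_cut (h : RoundRel S H R) (hfin : S.Finite) {u : β} (hu : u ∈ S)
    (hc : ∀ a b, H a b → side a ≠ side b) :
    ∃ (side' : β → Bool) (v : β), v ∈ S ∧ side' v = true ∧
      SidedOrder S H (twist side' R) side' ∧ ∀ a, ¬ twist side' R a v := by
  classical
  have hI := h.incOrder_twist hc
  have hgs : ∀ a b, Relation.ReflTransGen H a b → Relation.ReflTransGen H b a :=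
    by
    intro a b hab
    induction hab with
    | refl => exact .refl
    | tail _ hbc ih => exact .head (h.inc_symm _ _ hbc) ih
  let C : Set β := {a | a ∈ S ∧ Relation.ReflTransGen H u a}
  have hCfin : C.Finite := hfin.subset fun a ha => ha.1
  -- Within one component the twist is already transitive, so an element of `C` with fewest
  -- predecessors is minimal.
  obtain ⟨v, hvC, hvmin⟩ : ∃ v ∈ C, ∀ a ∈ C, ¬ twist side R a v := by
    have hmin := Set.exists_min_image C (fun v => {x | x ∈ C ∧ twist side R x v}.ncard) hCfin
      ⟨u, hu, .refl⟩
    obtain ⟨v, hv, hmin⟩ := hmin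
    refine ⟨v, hv, fun a ha hav => ?_⟩
    refine absurd (hmin a ha) (not_le.mpr (Set.ncard_lt_ncard ?_ (hCfin.subset fun x hx => hx.1)))
    have hsub : {x | x ∈ C ∧ twist side R x a} ⊆ {x | x ∈ C ∧ twist side R x v} := by
      refine fun x hx => ⟨hx.1, ?_⟩
      exact h.twist_trans_of_path hc ((hgs _ _ hx.1.2).trans ha.2) hx.2 hav
    exact (Set.ssubset_iff_of_subset hsub).mpr ⟨a, ⟨ha, hav⟩, fun e => hI.irrefl _ e.2⟩
  have hCstep : ∀ a b, H a b → (a ∈ C ↔ b ∈ C) := by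
    intro a b hab
    have hba := h.inc_symm _ _ hab
    have h1 := (h.inc_iff a b).1 hab
    exact ⟨fun ha => ⟨h1.2.1, ha.2.tail hab⟩, fun hb => ⟨h1.1, hb.2.tail hba⟩⟩
  -- On `C` this is the old colouring, normalised at `v`. Elsewhere the colour records the direction
  -- of the arrow between `v` and `a`, so that `v` precedes everything outside `C`.
  let s : β → Bool := fun a => if a ∈ C then decide (side a = side v) else decide (R v a)
  have hvS : v ∈ S := hvC.1
  have hsv : s v = true := by simp [s, hvC]
  have hproper : ∀ a b, H a b → s a ≠ s b := by
    intro a b hab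
    have h1 := hCstep a b hab
    have h2 := hc a b hab
    by_cases ha : a ∈ C
    · have hb := h1.1 ha
      simp only [s, ha, hb, if_true]
      cases h3 : side a <;> cases h4 : side b <;> cases h5 : side v <;> simp_all
    · have hb : b ∉ C := fun e => ha (h1.2 e)
      -- Joined elements `a`, `b` cannot both receive an arrow from `v`, nor both send one to `v`.
      have h3 := h.outOf v a b
      have h4 := h.into a b v
      have h5 := (h.inc_iff v a)
      have h6 := (h.inc_iff v b)
      have h7 := (h.inc_iff a b).1 hab
      have h8 : ¬ H v a := fun e => ha ((hCstep _ _ e).1 hvC)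
      have h9 : ¬ H v b := fun e => hb ((hCstep _ _ e).1 hvC)
      have e1 : a ≠ v := fun e => ha (e ▸ hvC)
      have e2 : b ≠ v := fun e => hb (e ▸ hvC)
      simp only [s, ha, hb, if_false]
      grind
  have hJ := h.incOrder_twist hproper
  have hvC' : ∀ a ∈ C, ∀ b ∈ C, (twist s R a b ↔ twist side R a b) := by
    intro a ha b hb
    have : s a = s b ↔ side a = side b := by
      simp only [s, ha, hb, if_true]
      cases h3 : side a <;> cases h4 : side b <;> cases h5 : side v <;> simp_all
    simp [twist, this]
  have hv : ∀ b ∈ S, b ∉ C → twist s R v b := by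
    intro b hbS hb
    have h6 := (h.inc_iff v b)
    have h9 : ¬ H v b := fun e => hb ((hCstep _ _ e).1 hvC)
    have e2 : b ≠ v := fun e => hb (e ▸ hvC)
    have e3 : s b = decide (R v b) := by simp [s, hb]
    unfold twist
    grind
  -- The comparison of `v` with `b` is carried along `H`-paths in `C`.
  have hall : ∀ a ∈ C, ∀ b ∈ S, b ∉ C → twist s R a b := by
    intro a ha b hbS hb
    have hva : Relation.ReflTransGen H v a := (hgs _ _ hvC.2).trans ha.2
    clear ha
    suffices a ∈ C ∧ twist s R a b from this.2
    induction hva with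
    | refl => exact ⟨hvC, hv b hbS hb⟩
    | @tail x y _ hxy ih =>
      have hy := (hCstep _ _ hxy).1 ih.1
      exact ⟨hy, (hJ.left _ _ _ ih.2 hxy).resolve_right fun e => hb ((hCstep _ _ e).1 hy)⟩
  refine ⟨s, v, hvS, hsv, ⟨hJ, fun a b hab => ?_, hproper, fun a b c hab hbc => ?_⟩, ?_⟩
  · have := (h.inc_iff a b).1 hab
    exact ⟨this.1, this.2.1⟩
  · have h1 := not_inc_of_chain hJ hab hbc
    have haS := (hJ.mem _ _ hab).1
    have hbS := (hJ.mem _ _ hbc).1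
    have hcS := (hJ.mem _ _ hbc).2
    have hac : a ≠ c := by
      rintro rfl
      exact hJ.asymm _ _ hab hbc
    rcases hJ.tri a c haS hcS hac with h2 | h2 | h2
    · exact h2
    · exfalso
      have n1 := hJ.asymm _ _ hab
      have n2 := hJ.asymm _ _ hbc
      have n3 := hJ.asymm _ _ h2
      -- As `C` precedes its complement, a cycle that meets `C` stays inside it, where `no_cycle`
      -- applies.
      by_cases ha : a ∈ C
      · have hc' : c ∈ C := by
          by_contra hc'
          exact n3 (hall a ha c hcS hc')
        have hb' : b ∈ C := by
          by_contra hb'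
          exact n2 (hall c hc' b hbS hb')
        rw [hvC' _ ha _ hb'] at hab
        rw [hvC' _ hb' _ hc'] at hbc
        rw [hvC' _ hc' _ ha] at h2
        exact h.no_cycle hc ((hgs _ _ ha.2).trans hb'.2) hab hbc h2
      -- Three of `v`, `a`, `b`, `c` form a directed cycle for `R`, and the arrows at the fourth
      -- violate `cycle`, whatever the colours.
      · have hb' : b ∉ C := fun e => n1 (hall b e a haS ha)
        have hc' : c ∉ C := fun e => n2 (hall c e b hbS hb')
        have ta := hv a haS ha
        have tb := hv b hbS hb'
        have tc := hv c hcS hc'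
        have va : v ≠ a := fun e => ha (e ▸ hvC)
        have vb : v ≠ b := fun e => hb' (e ▸ hvC)
        have vc : v ≠ c := fun e => hc' (e ▸ hvC)
        have bc : b ≠ c := by rintro rfl; exact hJ.irrefl _ hbc
        have ab : a ≠ b := by rintro rfl; exact hJ.irrefl _ hab
        have hcy := h.cycle
        have has := h.asymm
        unfold twist at hab hbc h2 ta tb tc
        rw [hsv] at ta tb tc
        cases sa : s a <;> cases sb : s b <;> cases sc : s c <;>
          simp only [sa, sb, sc, reduceCtorEq, ne_eq, not_true_eq_false, not_false_eq_true,
            true_and, false_and, or_false, false_or] at hab hbc h2 ta tb tc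
        all_goals grind
    · exact absurd h2 h1
  · intro a hav
    have haS := (hJ.mem _ _ hav).1
    by_cases ha : a ∈ C
    · exact hvmin a ha ((hvC' _ ha _ hvC).1 hav)
    · exact hJ.asymm _ _ hav (hv a haS ha)

end RoundRel

/-! ### Twins and lists sorted by sided orders. -/

/-- Two elements with the same nonempty `H`-neighborhood. -/
def Twin {β : Type*} (H : β → β → Prop) (a b : β) : Prop := (∃ e, H a e) ∧ SameNbhd H a b

/-- The order in which the elements of the first side come before those of the second. -/
def SidedBefore {β : Type*} (side : β → Bool) (lt : β → β → Prop) (a b : β) : Prop :=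
  (side a = true ∧ side b = false) ∨ (side a = side b ∧ lt a b)

theorem Twin.symm {β : Type*} {H : β → β → Prop} {a b : β} (h : Twin H a b) : Twin H b a :=
  ⟨h.1.imp fun e he => (h.2 e).1 he, fun e => (h.2 e).symm⟩

theorem Twin.trans {β : Type*} {H : β → β → Prop} {a b c : β} (h : Twin H a b)
    (h' : Twin H b c) : Twin H a c :=
  ⟨h.1, fun e => (h.2 e).trans (h'.2 e)⟩

namespace SidedOrder

variable {β : Type*} {S : Set β} {H lt lt' : β → β → Prop} {side : β → Bool}

theorem twin_side (h : SidedOrder S H lt side) {a b : β} (hab : Twin H a b) :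
    side a = side b := by
  obtain ⟨⟨e, he⟩, hn⟩ := hab
  exact bool_eq_of_ne (h.proper _ _ he) (h.proper _ _ ((hn e).1 he))

theorem twin_mem (h : SidedOrder S H lt side) {a b : β} (hab : Twin H a b) : a ∈ S ∧ b ∈ S := by
  obtain ⟨⟨e, he⟩, hn⟩ := hab
  exact ⟨(h.inc_mem _ _ he).1, (h.inc_mem _ _ ((hn e).1 he)).1⟩

/-- Twins are convex for a sided order. -/
theorem twin_convex (h : SidedOrder S H lt side) {x a b : β} (hxb : Twin H x b) (hxa : lt x a)
    (hab : lt a b) : Twin H x a := by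
  refine ⟨hxb.1, ?_⟩
  obtain ⟨⟨f, hf⟩, hn⟩ := hxb
  have hbf := (hn f).1 hf
  obtain ⟨⟨p1, p2, p3, p4, p5, p6, p7⟩, p8, p9, p10⟩ := h
  have haS := (p1 _ _ hab).1
  have hbS := (p1 _ _ hab).2
  -- Such an `e` would satisfy `x < e < b`. Being of the colour of `f`, it is comparable with `f`,
  -- which makes `f` comparable with `x` or `b`.
  have key : ∀ e, side e = side f → e ∈ S → H a e → H x e := by
    intro e hef heS hae
    by_contra hxe
    have h1 := p7 _ _ _ hxa hae
    have h2 := p6 _ _ _ hab hae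
    have h3 := (hn e)
    have h4 := p4 b e
    have h5 : lt x e := h1.resolve_right hxe
    have h6 : lt e b := h2.resolve_right (by tauto)
    have hne : e ≠ f := by rintro rfl; exact hxe hf
    rcases p3 e f heS (p8 _ _ hf).2 hne with h7 | h7 | h7
    · exact p5 _ _ (p10 _ _ _ h5 h7) hf
    · exact p5 _ _ (p10 _ _ _ h7 h6) (p4 _ _ hbf)
    · exact p9 _ _ h7 hef
  have hfa : H a f := by
    by_contra hfa
    have hne : f ≠ a := by rintro rfl; exact p5 _ _ hxa hf
    rcases p3 f a (p8 _ _ hf).2 haS hne with h7 | h7 | h7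
    · exact p5 _ _ (p10 _ _ _ h7 hab) (p4 _ _ hbf)
    · exact p5 _ _ (p10 _ _ _ hxa h7) hf
    · exact hfa (p4 _ _ h7)
  intro e
  constructor
  · intro hxe
    have hbe := (hn e).1 hxe
    have hne : e ≠ a := by rintro rfl; exact p5 _ _ hxa hxe
    rcases p3 e a (p8 _ _ hxe).2 haS hne with h7 | h7 | h7
    · exact (p5 _ _ (p10 _ _ _ h7 hab) (p4 _ _ hbe)).elim
    · exact (p5 _ _ (p10 _ _ _ hxa h7) hxe).elim
    · exact p4 _ _ h7
  · intro hae
    exact key e (bool_eq_of_ne (Ne.symm (p9 _ _ hae)) (Ne.symm (p9 _ _ hfa))) (p8 _ _ hae).2 hae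

/-- Passing from `a` to its twin `b` cannot cross `x`, because twin classes are convex. -/
theorem lt_of_lt_of_twin (h : SidedOrder S H lt side) {x a b : β} (hxa : lt x a)
    (hn : ¬ Twin H x a) (hab : Twin H a b) : lt x b := by
  have hxb : x ≠ b := by rintro rfl; exact hn hab.symm
  rcases h.tri x b (h.mem _ _ hxa).1 (h.twin_mem hab).2 hxb with h1 | h1 | h1
  · exact h1
  · exact (hn ((h.twin_convex hab.symm h1 hxa).symm.trans hab.symm)).elim
  · exact (h.not_inc _ _ hxa (h.symm _ _ ((hab.2 x).2 (h.symm _ _ h1)))).elim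

theorem lt_of_twin_of_lt (h : SidedOrder S H lt side) {x a b : β} (hax : lt a x)
    (hn : ¬ Twin H a x) (hab : Twin H a b) : lt b x := by
  have hxb : b ≠ x := by rintro rfl; exact hn hab
  rcases h.tri b x (h.twin_mem hab).2 (h.mem _ _ hax).2 hxb with h1 | h1 | h1
  · exact h1
  · exact (hn (h.twin_convex hab hax h1)).elim
  · exact (h.not_inc _ _ hax ((hab.2 x).2 h1)).elim

/-- Sorting by two sided orders that agree on all pairs but twins gives lists that differ only by
an exchange of twins. -/
theorem sorted_twin (h : SidedOrder S H lt side) (hS : S.Finite)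
    (hagree : ∀ a b, ¬ Twin H a b → (lt a b ↔ lt' a b)) {L M : List β} (hLM : L.Perm M)
    (hmem : ∀ a ∈ L, a ∈ S) (hM : M.Pairwise (SidedBefore side lt))
    (hL : L.Pairwise (SidedBefore side lt')) (k : ℕ) (hk : k < L.length) (hk' : k < M.length) :
    L[k] = M[k] ∨ Twin H L[k] M[k] := by
  -- Comparisons of twins are forgotten, so `rank` is constant on twin classes and separates
  -- everything else.
  let spre : β → β → Prop := fun x a =>
    (side x = true ∧ side a = false) ∨ (side x = side a ∧ lt x a ∧ ¬ Twin H x a)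
  let rank : β → ℕ := fun a => {x | x ∈ S ∧ spre x a}.ncard
  have hfin : ∀ a, {x | x ∈ S ∧ spre x a}.Finite := fun a => hS.subset fun x hx => hx.1
  have irr : ∀ a, ¬ spre a a := by
    rintro a (h1 | h1)
    · simp_all
    · exact h.irrefl _ h1.2.1
  have tr : ∀ a b c, spre a b → spre b c → spre a c := by
    rintro a b c (h1 | h1) (h2 | h2)
    · simp_all
    · exact Or.inl ⟨h1.1, h2.1 ▸ h1.2⟩
    · exact Or.inl ⟨h1.1 ▸ h2.1, h2.2⟩
    · exact Or.inr ⟨h1.1.trans h2.1, h.trans _ _ _ h1.2.1 h2.2.1,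
        fun e => h1.2.2 (h.twin_convex e h1.2.1 h2.2.1)⟩
  have lt_rank : ∀ a b, a ∈ S → spre a b → rank a < rank b := by
    intro a b ha hab
    have hsub : {x | x ∈ S ∧ spre x a} ⊆ {x | x ∈ S ∧ spre x b} :=
      fun x hx => ⟨hx.1, tr _ _ _ hx.2 hab⟩
    exact Set.ncard_lt_ncard
      ((Set.ssubset_iff_of_subset hsub).mpr ⟨a, ⟨ha, hab⟩, fun e => irr _ e.2⟩) (hfin b)
  have le_rank : ∀ a b, Twin H a b → rank a ≤ rank b := by
    intro a b hab
    refine Set.ncard_le_ncard (fun x hx => ⟨hx.1, ?_⟩) (hfin b)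
    have hs := h.twin_side hab
    rcases hx.2 with h1 | h1
    · exact Or.inl (hs ▸ h1)
    · exact Or.inr ⟨h1.1.trans hs, h.lt_of_lt_of_twin h1.2.1 h1.2.2 hab,
        fun e => h1.2.2 (e.trans hab.symm)⟩
  have rank_inj : ∀ a b, a ∈ S → b ∈ S → rank a = rank b → a = b ∨ Twin H a b := by
    intro a b ha hb hab
    by_contra hcon
    push Not at hcon
    have n1 : ¬ spre a b := fun e => (lt_rank a b ha e).ne hab
    have n2 : ¬ spre b a := fun e => (lt_rank b a hb e).ne hab.symm
    have hs : side a = side b := by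
      cases h1 : side a <;> cases h2 : side b <;> simp_all [spre]
    have h3 : ¬ Twin H b a := fun e => hcon.2 e.symm
    rcases h.tri a b ha hb hcon.1 with h4 | h4 | h4
    · exact n1 (Or.inr ⟨hs, h4, hcon.2⟩)
    · exact n2 (Or.inr ⟨hs.symm, h4, h3⟩)
    · exact h.proper _ _ h4 hs
  have hmemM : ∀ a ∈ M, a ∈ S := fun a ha => hmem a (hLM.mem_iff.mpr ha)
  have sorted : ∀ (N : List β) (l : β → β → Prop), (∀ a ∈ N, a ∈ S) →
      (∀ a b, ¬ Twin H a b → (lt a b ↔ l a b)) → N.Pairwise (SidedBefore side l) →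
      (N.map rank).Pairwise (· ≤ ·) := by
    intro N l hN hl hp
    rw [List.pairwise_map]
    refine hp.imp_of_mem fun {a b} ha hb hab => ?_
    by_cases ht : Twin H a b
    · exact le_rank _ _ ht
    · refine (lt_rank a b (hN a ha) ?_).le
      rcases hab with h1 | h1
      · exact Or.inl h1
      · exact Or.inr ⟨h1.1, (hl a b ht).2 h1.2, ht⟩
  -- Both lists of ranks are weakly increasing and permutations of each other.
  have heq : L.map rank = M.map rank :=
    (hLM.map rank).eq_of_pairwise' (sorted L lt' hmem hagree hL)
      (sorted M lt hmemM (fun _ _ _ => Iff.rfl) hM)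
  refine rank_inj _ _ (hmem _ (List.getElem_mem _)) (hmemM _ (List.getElem_mem _)) ?_
  have := congrArg (fun l => l[k]?) heq
  simpa [hk, hk'] using this

theorem sidedBefore_iff {L : List β} (h : SidedOrder S H lt side)
    (hL : L.Pairwise (SidedBefore side lt)) {i j : ℕ} (hi : i < L.length) (hj : j < L.length)
    (hs : side L[i] = side L[j]) : lt L[i] L[j] ↔ i < j := by
  rw [List.pairwise_iff_getElem] at hL
  have key : ∀ i j (hi : i < L.length) (hj : j < L.length), i < j → side L[i] = side L[j] →
      lt L[i] L[j] := by
    intro i j hi hj hij hs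
    rcases hL i j hi hj hij with h1 | h1
    · simp_all
    · exact h1.2
  refine ⟨fun hlt => ?_, fun hij => key i j hi hj hij hs⟩
  by_contra hij
  rcases (not_lt.mp hij).lt_or_eq with h1 | h1
  · exact h.asymm _ _ hlt (key j i hj hi h1 hs.symm)
  · subst h1
    exact h.irrefl _ hlt

/-- For equal colours both sides say that `i < j`. For different colours, replacing an element by a
twin does not change the comparison. Hence the two relations agree position by position. -/
theorem sorted_twist_iff (h : SidedOrder S H lt side) (h' : SidedOrder S H lt' side)
    (hS : S.Finite) (hagree : ∀ a b, ¬ Twin H a b → (lt a b ↔ lt' a b)) {L M : List β}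
    (hLM : L.Perm M) (hmem : ∀ a ∈ L, a ∈ S) (hM : M.Pairwise (SidedBefore side lt))
    (hL : L.Pairwise (SidedBefore side lt')) {i j : ℕ} (hi : i < L.length) (hi' : i < M.length)
    (hj : j < L.length) (hj' : j < M.length) :
    twist side lt M[i] M[j] ↔ twist side lt' L[i] L[j] := by
  have t1 := h.sorted_twin hS hagree hLM hmem hM hL i hi hi'
  have t2 := h.sorted_twin hS hagree hLM hmem hM hL j hj hj'
  have s1 : side L[i] = side M[i] := t1.elim (fun e => by rw [e]) h.twin_side
  have s2 : side L[j] = side M[j] := t2.elim (fun e => by rw [e]) h.twin_side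
  by_cases hs : side M[i] = side M[j]
  · have hs' : side L[i] = side L[j] := by rw [s1, s2, hs]
    simp only [twist, hs, hs', true_and, ne_eq, not_true_eq_false, false_and, or_false]
    rw [h.sidedBefore_iff hM hi' hj' hs, h'.sidedBefore_iff hL hi hj hs']
  · have hs' : ¬ side L[i] = side L[j] := by rwa [s1, s2]
    simp only [twist, hs, hs', false_and, ne_eq, not_false_eq_true, true_and, false_or]
    have n1 : ¬ Twin H L[j] L[i] := fun e => hs' (h.twin_side e).symm
    have n2 : ¬ Twin H M[j] M[i] := fun e => hs (h.twin_side e).symm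
    have n3 : ¬ Twin H L[j] M[i] := fun e => hs' (by rw [s1, h.twin_side e])
    rw [← hagree _ _ n1]
    constructor
    · intro h1
      have h2 : lt L[j] M[i] := by
        rcases t2 with e | e
        · rwa [e]
        · exact h.lt_of_twin_of_lt h1 n2 e.symm
      rcases t1 with e | e
      · rwa [e]
      · exact h.lt_of_lt_of_twin h2 n3 e.symm
    · intro h1
      have h2 : lt L[j] M[i] := by
        rcases t1 with e | e
        · rwa [← e]
        · exact h.lt_of_lt_of_twin h1 n1 e
      rcases t2 with e | e
      · rwa [← e]
      · exact h.lt_of_twin_of_lt h2 n3 e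

end SidedOrder

/-! ### Arrows and circular positions. -/

/-- `x`, `y`, `z` occur in this order on a circle. -/
def CycLt (x y z : ℕ) : Prop := (x < y ∧ y < z) ∨ (y < z ∧ z < x) ∨ (z < x ∧ x < y)

theorem Fin.sub_val_cases {n : ℕ} (x y : Fin n) :
    (y.val ≤ x.val ∧ (x - y).val + y.val = x.val) ∨
      (x.val < y.val ∧ (x - y).val + y.val = x.val + n) := by
  rcases le_or_gt y x with h | h
  · left
    have := Fin.sub_val_of_le h
    have h' : y.val ≤ x.val := h
    omega
  · right
    have := Fin.coe_sub_iff_lt.mpr h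
    have h' : x.val < y.val := h
    omega

namespace RoundRep

variable {α : Type*} (Φ : RoundRep α)

theorem arrow_block_iff (i j : Fin Φ.n) : Φ.Arrow (Φ.block i) (Φ.block j) ↔ Φ.To i j := by
  constructor
  · rintro ⟨i', j', hi, hj, h⟩
    rwa [Φ.block_injective hi, Φ.block_injective hj] at h
  · exact fun h => ⟨i, j, rfl, rfl, h⟩

theorem to_between {i j k : Fin Φ.n} (h : CycLt i k j) (hij : Φ.To i j) :
    Φ.To i k ∧ Φ.To k j := by
  have h1 := Fin.sub_val_cases k i
  have h2 := Fin.sub_val_cases j i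
  have h3 := Fin.sub_val_cases j k
  have h5 := i.isLt
  have h6 := j.isLt
  have h7 := k.isLt
  unfold CycLt at h
  refine ⟨⟨?_, ?_⟩, Φ.to_of_le j ((j - i).val - (j - k).val) i k (by omega) hij ?_⟩
  · rintro rfl
    omega
  · refine le_trans ?_ hij.2
    rw [Fin.le_def]
    omega
  · rintro rfl
    omega

theorem order_length : Φ.order.length = Φ.n := by simp [order]

theorem order_getElem (k : ℕ) (hk : k < Φ.order.length) :
    Φ.order[k] = Φ.block ⟨k, by rwa [order_length] at hk⟩ := by
  simp [order]

theorem order_nodup : Φ.order.Nodup := List.nodup_ofFn.mpr Φ.block_injective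

theorem mem_order {B : Set α} : B ∈ Φ.order ↔ B ∈ Φ.graph.semiblocks := by
  simp [order, graph, List.mem_ofFn]

theorem add_mod_cases {x m n : ℕ} (hx : x < n) :
    (x + m) % n = x + m % n ∨ (x + m) % n + n = x + m % n := by
  have hm : m % n < n := Nat.mod_lt _ (by omega)
  rw [Nat.add_mod, Nat.mod_eq_of_lt hx]
  rcases lt_or_ge (x + m % n) n with h | h
  · exact Or.inl (Nat.mod_eq_of_lt h)
  · right
    rw [Nat.mod_eq_sub_mod h, Nat.mod_eq_of_lt (by omega)]
    omega

/-- Cyclic betweenness is invariant under rotation, so positions in any rotated list can replace the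
original indices. -/
theorem arrow_between {L : List (Set α)} (hL : L ~r Φ.order) {i j k : ℕ} (hi : i < L.length)
    (hj : j < L.length) (hk : k < L.length) (h : CycLt i k j) (hij : Φ.Arrow L[i] L[j]) :
    Φ.Arrow L[i] L[k] ∧ Φ.Arrow L[k] L[j] := by
  obtain ⟨m, rfl⟩ := hL.symm
  simp only [List.getElem_rotate, order_getElem, arrow_block_iff] at hij ⊢
  simp only [List.length_rotate] at hi hj hk
  have h1 := add_mod_cases (m := m) hi
  have h2 := add_mod_cases (m := m) hj
  have h3 := add_mod_cases (m := m) hk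
  have h4 : m % Φ.order.length < Φ.order.length := Nat.mod_lt _ (by omega)
  have h5 := Nat.mod_lt (i + m) (y := Φ.order.length) (by omega)
  have h6 := Nat.mod_lt (j + m) (y := Φ.order.length) (by omega)
  have h7 := Nat.mod_lt (k + m) (y := Φ.order.length) (by omega)
  refine Φ.to_between ?_ hij
  unfold CycLt at h ⊢
  simp only
  omega

theorem arrow_mem {B W : Set α} (h : Φ.Arrow B W) :
    B ∈ Φ.graph.semiblocks ∧ W ∈ Φ.graph.semiblocks := by
  obtain ⟨i, j, rfl, rfl, _⟩ := h
  exact ⟨⟨i, rfl⟩, ⟨j, rfl⟩⟩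

theorem arrow_asymm {B W : Set α} (h : Φ.Arrow B W) : ¬ Φ.Arrow W B := by
  obtain ⟨i, j, rfl, rfl, h⟩ := h
  rw [arrow_block_iff]
  exact fun h' => Φ.normal i j ⟨h, h'⟩

theorem arrow_ne {B W : Set α} (h : Φ.Arrow B W) : B ≠ W := by
  rintro rfl
  exact Φ.arrow_asymm h h

theorem graph_adj {B W : Set α} : Φ.graph.Adj B W ↔ Φ.Arrow B W ∨ Φ.Arrow W B := by
  constructor
  · rintro ⟨_, _, h⟩
    exact h
  · intro h
    have : B ∈ Φ.graph.semiblocks ∧ W ∈ Φ.graph.semiblocks :=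
      h.elim Φ.arrow_mem fun h => (Φ.arrow_mem h).symm
    exact ⟨this.1, this.2, h⟩

end RoundRep

/-! ### Co-adjacency and co-components. -/

namespace SemiblockGraph

variable {α : Type*} (G : SemiblockGraph α)

/-- Two distinct semiblocks of `G` are not adjacent. -/
def CoAdj (B W : Set α) : Prop :=
  B ∈ G.semiblocks ∧ W ∈ G.semiblocks ∧ B ≠ W ∧ ¬ G.Adj B W

theorem adj_symm {B W : Set α} (h : G.Adj B W) : G.Adj W B := by
  obtain ⟨h1, h2, h3⟩ := h
  exact ⟨h2, h1, h3.symm⟩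

theorem coAdj_symm {B W : Set α} (h : G.CoAdj B W) : G.CoAdj W B :=
  ⟨h.2.1, h.1, h.2.2.1.symm, fun e => h.2.2.2 (G.adj_symm e)⟩

theorem ext_adj {G G' : SemiblockGraph α} (h1 : G.semiblocks = G'.semiblocks)
    (h2 : ∀ B W, G.Adj B W ↔ G'.Adj B W) : G = G' := by
  obtain ⟨S, hn, hd, g⟩ := G
  obtain ⟨S', hn', hd', g'⟩ := G'
  simp only at h1
  subst h1
  congr
  ext ⟨B, hB⟩ ⟨W, hW⟩
  have := h2 B W
  simpa [Adj, hB, hW] using this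

theorem compl_adj_iff {B W : Set α} (hB : B ∈ G.semiblocks) (hW : W ∈ G.semiblocks) :
    G.graphᶜ.Adj ⟨B, hB⟩ ⟨W, hW⟩ ↔ G.CoAdj B W := by
  simp [CoAdj, Adj, hB, hW, SimpleGraph.compl_adj]

theorem exists_coloring (h : G.IsCoBipartite) :
    ∃ c : Set α → Bool, ∀ B W, G.CoAdj B W → c B ≠ c W := by
  classical
  obtain ⟨c⟩ := h
  refine ⟨fun B => if hB : B ∈ G.semiblocks then decide (c ⟨B, hB⟩ = 0) else true, ?_⟩
  intro B W hBW
  have h1 := c.valid ((G.compl_adj_iff hBW.1 hBW.2.1).mpr hBW)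
  simp only [hBW.1, hBW.2.1, dif_pos]
  intro h2
  apply h1
  rw [decide_eq_decide] at h2
  omega

theorem isCoComponent_iff {𝒞 : Set (Set α)} : G.IsCoComponent 𝒞 ↔
    ∃ B ∈ G.semiblocks, 𝒞 = {W | Relation.ReflTransGen G.CoAdj B W} := by
  have key : ∀ (B : Set α) (hB : B ∈ G.semiblocks),
      Subtype.val '' (G.graphᶜ.connectedComponentMk ⟨B, hB⟩).supp =
        {W | Relation.ReflTransGen G.CoAdj B W} := by
    intro B hB
    ext W
    simp only [Set.mem_image, Set.mem_ofPred_eq, SimpleGraph.ConnectedComponent.mem_supp_iff,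
      SimpleGraph.ConnectedComponent.eq]
    constructor
    · rintro ⟨⟨W, hW⟩, h, rfl⟩
      have h := SimpleGraph.reachable_iff_reflTransGen _ _ |>.mp h.symm
      exact h.lift Subtype.val fun a b hab => (G.compl_adj_iff a.2 b.2).mp hab
    · intro h
      induction h with
      | refl => exact ⟨⟨B, hB⟩, .refl _, rfl⟩
      | @tail W V _ hWV ih =>
        obtain ⟨⟨W, hW⟩, h, rfl⟩ := ih
        refine ⟨⟨V, hWV.2.1⟩, ?_, rfl⟩
        exact (((G.compl_adj_iff hW hWV.2.1).mpr hWV).reachable.symm).trans h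
  constructor
  · rintro ⟨C, rfl⟩
    induction C using SimpleGraph.ConnectedComponent.ind with
    | h B => exact ⟨B.1, B.2, key B.1 B.2⟩
  · rintro ⟨B, hB, rfl⟩
    exact ⟨_, (key B hB).symm⟩

end SemiblockGraph

/-! ### From a round representation to a sided order. -/

namespace RoundRep

variable {α : Type*} (Φ : RoundRep α)

theorem coAdj_iff {B W : Set α} : Φ.graph.CoAdj B W ↔ B ∈ Φ.graph.semiblocks ∧
    W ∈ Φ.graph.semiblocks ∧ B ≠ W ∧ ¬ Φ.Arrow B W ∧ ¬ Φ.Arrow W B := by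
  simp [SemiblockGraph.CoAdj, graph_adj]

theorem exists_getElem_order {B : Set α} (h : B ∈ Φ.graph.semiblocks) :
    ∃ (i : ℕ) (hi : i < Φ.order.length), Φ.order[i] = B :=
  List.getElem_of_mem (Φ.mem_order.mpr h)

/-- Of two arrows into, or out of, one semiblock, the longer passes over the other end of the
shorter. The arcs of a directed triangle cover the circle, so a fourth semiblock lies under one of
them. -/
theorem roundRel : RoundRel Φ.graph.semiblocks Φ.graph.CoAdj Φ.Arrow where
  mem _ _ h := Φ.arrow_mem h
  inc_iff _ _ := Φ.coAdj_iff
  asymm _ _ h := Φ.arrow_asymm h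
  into a b c hac hbc h := by
    rw [coAdj_iff] at h
    obtain ⟨i, hi, rfl⟩ := Φ.exists_getElem_order h.1
    obtain ⟨j, hj, rfl⟩ := Φ.exists_getElem_order h.2.1
    obtain ⟨k, hk, rfl⟩ := Φ.exists_getElem_order (Φ.arrow_mem hac).2
    have n1 : i ≠ j := by rintro rfl; exact h.2.2.1 rfl
    have n2 : i ≠ k := by rintro rfl; exact Φ.arrow_ne hac rfl
    have n3 : j ≠ k := by rintro rfl; exact Φ.arrow_ne hbc rfl
    have hc : CycLt i j k ∨ CycLt j i k := by unfold CycLt; omega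
    rcases hc with hc | hc
    · exact h.2.2.2.1 (Φ.arrow_between (.refl _) hi hk hj hc hac).1
    · exact h.2.2.2.2 (Φ.arrow_between (.refl _) hj hk hi hc hbc).1
  outOf a b c hab hac h := by
    rw [coAdj_iff] at h
    obtain ⟨j, hj, rfl⟩ := Φ.exists_getElem_order h.1
    obtain ⟨k, hk, rfl⟩ := Φ.exists_getElem_order h.2.1
    obtain ⟨i, hi, rfl⟩ := Φ.exists_getElem_order (Φ.arrow_mem hac).1
    have n1 : j ≠ k := by rintro rfl; exact h.2.2.1 rfl
    have n2 : i ≠ k := by rintro rfl; exact Φ.arrow_ne hac rfl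
    have n3 : i ≠ j := by rintro rfl; exact Φ.arrow_ne hab rfl
    have hc : CycLt i j k ∨ CycLt i k j := by unfold CycLt; omega
    rcases hc with hc | hc
    · exact h.2.2.2.1 (Φ.arrow_between (.refl _) hi hk hj hc hac).2
    · exact h.2.2.2.2 (Φ.arrow_between (.refl _) hi hj hk hc hab).2
  cycle a b c d hab hbc hca hd hda hdb hdc := by
    obtain ⟨i, hi, rfl⟩ := Φ.exists_getElem_order (Φ.arrow_mem hab).1
    obtain ⟨j, hj, rfl⟩ := Φ.exists_getElem_order (Φ.arrow_mem hab).2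
    obtain ⟨k, hk, rfl⟩ := Φ.exists_getElem_order (Φ.arrow_mem hbc).2
    obtain ⟨l, hl, rfl⟩ := Φ.exists_getElem_order hd
    have n1 : l ≠ i := by rintro rfl; exact hda rfl
    have n2 : l ≠ j := by rintro rfl; exact hdb rfl
    have n3 : l ≠ k := by rintro rfl; exact hdc rfl
    have n4 : ¬ CycLt i k j := fun e =>
      Φ.arrow_asymm hca (Φ.arrow_between (.refl _) hi hj hk e hab).1
    have n5 : i ≠ j := by rintro rfl; exact Φ.arrow_ne hab rfl
    have n6 : j ≠ k := by rintro rfl; exact Φ.arrow_ne hbc rfl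
    have n7 : k ≠ i := by rintro rfl; exact Φ.arrow_ne hca rfl
    have hc : CycLt i l j ∨ CycLt j l k ∨ CycLt k l i := by unfold CycLt at *; omega
    rcases hc with hc | hc | hc
    · exact Or.inl (Φ.arrow_between (.refl _) hi hj hl hc hab)
    · exact Or.inr (Or.inl (Φ.arrow_between (.refl _) hj hk hl hc hbc))
    · exact Or.inr (Or.inr (Φ.arrow_between (.refl _) hk hi hl hc hca))

theorem finite_semiblocks : Φ.graph.semiblocks.Finite := Set.finite_range _

/-- A round representation of a co-bipartite graph can be cut into a sided order that sorts a
rotation of its circular ordering. -/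
theorem exists_sidedOrder (h : Φ.graph.IsCoBipartite) :
    ∃ (side : Set α → Bool) (M : List (Set α)), M ~r Φ.order ∧
      SidedOrder Φ.graph.semiblocks Φ.graph.CoAdj (twist side Φ.Arrow) side ∧
      M.Pairwise (SidedBefore side (twist side Φ.Arrow)) := by
  obtain ⟨c, hc⟩ := Φ.graph.exists_coloring h
  have hR := Φ.roundRel
  rcases Φ.graph.semiblocks.eq_empty_or_nonempty with he | ⟨u, hu⟩
  · refine ⟨c, Φ.order, .refl _, ⟨hR.incOrder_twist hc, fun a b hab => ⟨hab.1, hab.2.1⟩, hc, ?_⟩, ?_⟩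
    · intro a b c' hab
      have := ((hR.incOrder_twist hc).mem _ _ hab).1
      simp [he] at this
    · have : Φ.order = [] := List.eq_nil_iff_forall_not_mem.mpr fun B hB => by
        rw [mem_order, he] at hB
        exact hB
      simp [this]
  obtain ⟨side, v, hv, hsv, hS, hmin⟩ := hR.exists_cut Φ.finite_semiblocks hu hc
  obtain ⟨m, hm, hmv⟩ := Φ.exists_getElem_order hv
  let M := Φ.order.rotate m
  have hMr : M ~r Φ.order := List.IsRotated.symm ⟨m, rfl⟩
  have hlen : M.length = Φ.order.length := List.length_rotate _ _
  have h0 : 0 < M.length := by omega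
  have hM0 : M[0] = v := by
    simp only [M, List.getElem_rotate]
    rw [← hmv]
    congr 1
    simpa using Nat.mod_eq_of_lt hm
  have hMn : M.Nodup := List.nodup_rotate.mpr Φ.order_nodup
  have hMmem : ∀ i (hi : i < M.length), M[i] ∈ Φ.graph.semiblocks := fun i hi => by
    rw [← mem_order, ← hMr.mem_iff]
    exact List.getElem_mem _
  refine ⟨side, M, hMr, hS, List.pairwise_iff_getElem.mpr fun i j hi hj hij => ?_⟩
  have hne : M[i] ≠ M[j] := fun e => hij.ne (hMn.getElem_inj_iff.mp e)
  have hj0 : M[j] ≠ v := fun e => by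
    rw [← hM0] at e
    have := hMn.getElem_inj_iff.mp e
    omega
  -- By minimality `B` is above `v` or joined to it; in either case its colour decides whether `v →
  -- B`.
  have hv1 : ∀ B ∈ Φ.graph.semiblocks, B ≠ v → (Φ.Arrow v B ↔ side B = true) := by
    intro B hB hBv
    have h1 := hmin B
    have h2 := hS.tri _ _ hB hv hBv
    have h3 := hS.proper B v
    have h4 := Φ.coAdj_iff (B := B) (W := v)
    have h5 := @Φ.arrow_asymm
    unfold twist at h1 h2
    rw [hsv] at h1 h2 h3
    grind
  have hj1 := hv1 _ (hMmem j hj) hj0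
  have hi1 := hv1 _ (hMmem i hi)
  have hcy : i ≠ 0 → CycLt 0 i j ∧ CycLt j 0 i := by unfold CycLt; omega
  unfold SidedBefore
  have e1 : side M[j] = true → side M[i] = true := by
    intro e
    by_cases hi0 : i = 0
    · subst hi0; rw [hM0, hsv]
    · have h1 := (Φ.arrow_between hMr h0 hj hi (hcy hi0).1 (by rw [hM0]; exact hj1.mpr e)).1
      rw [hM0] at h1
      refine (hi1 ?_).mp h1
      rintro e'
      exact Φ.arrow_ne h1 e'.symm
  by_cases hs : side M[i] = side M[j]
  · right
    refine ⟨hs, ?_⟩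
    rcases hS.tri _ _ (hMmem i hi) (hMmem j hj) hne with h1 | h1 | h1
    · exact h1
    · exfalso
      by_cases hi0 : i = 0
      · subst hi0
        rw [hM0] at h1
        exact hmin _ h1
      -- Such an arrow would wrap past `v`, giving `M[j] → v → M[i]`. Then both have colour `true`,
      -- so that also `v → M[j]`.
      · have h2 : Φ.Arrow M[j] M[i] := by simpa [twist, hs] using h1
        have h3 := Φ.arrow_between hMr hj hi h0 (hcy hi0).2 h2
        rw [hM0] at h3
        have h4 := (hi1 (Φ.arrow_ne h3.2).symm).mp h3.2
        exact Φ.arrow_asymm h3.1 (hj1.mpr (hs ▸ h4))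
    · exact (hS.proper _ _ h1 hs).elim
  · left
    cases h1 : side M[i] <;> cases h2 : side M[j] <;> simp_all

end RoundRep

/-! ### Far neighbors, construction and equality of representations. -/

namespace RoundRep

variable {α : Type*} (Φ : RoundRep α)

theorem to_iff {i j : Fin Φ.n} : Φ.To i j ↔ j ≠ i ∧ (j - i).val ≤ (Φ.Fr i - i).val := Iff.rfl

/-- By `to_of_le` the sources of arrows into `i` are consecutive and end just before `i`; they begin
at the left far neighbor, if there are any. -/
theorem to_left_iff (i k : Fin Φ.n) (hk : k ≠ i) :
    Φ.To k i ↔ (i - k).val ≤ (i - Φ.Fl i).val := by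
  have hl : Φ.IsLeftFar i (Φ.Fl i) := (Φ.existsUnique_isLeftFar i).choose_spec.1
  generalize Φ.Fl i = l at hl ⊢
  have c1 := Fin.sub_val_cases i k
  have c2 := Fin.sub_val_cases i l
  have hkn := k.isLt
  have hin := i.isLt
  have hln := l.isLt
  have hkv : k.val ≠ i.val := fun e => hk (Fin.ext e)
  constructor
  · intro hki
    by_contra hlt
    by_cases hp : (finRotate Φ.n).symm l = i
    · have h1 : l = finRotate Φ.n i := by rw [← hp, Equiv.apply_symm_apply]
      by_cases hil : i = l
      · obtain ⟨m, hm⟩ : ∃ m, Φ.n = m + 2 := ⟨Φ.n - 2, by omega⟩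
        have key : ∀ n : ℕ, n = m + 2 → ∀ i : Fin n, finRotate n i ≠ i := by
          rintro _ rfl i
          rw [finRotate_apply]
          simp
        exact key _ hm i (hil.trans h1).symm
      · have key : ∀ (n : ℕ) (i : Fin n), finRotate n i ≠ i → (i - finRotate n i).val + 1 = n := by
          intro n i hi
          obtain _ | n := n
          · exact i.elim0
          · rw [finRotate_apply]
            simp
        have := key _ i (by rw [← h1]; exact Ne.symm hil)
        rw [← h1] at this
        omega
    · have h1 := sub_val_of_rotate _ i hp
      rw [Equiv.apply_symm_apply] at h1
      rcases hl.2 with h2 | h2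
      · exact hp h2
      · exact h2 (Φ.to_of_le i ((i - k).val - (i - (finRotate Φ.n).symm l).val) k _
          (by omega) hki hp)
  · intro hle
    rcases hl.1 with h1 | h1
    · exact Φ.to_of_le i ((i - l).val - (i - k).val) l k (by omega) h1 hk
    · subst h1
      omega

/-- By `normal` the ranges `[F_l i, i]` and `[i, F_r i]` meet only in `i`, so they combine into one
range. -/
theorem inRange_far_iff (i k : Fin Φ.n) :
    InRange (Φ.Fl i) (Φ.Fr i) k ↔ k = i ∨ Φ.To i k ∨ Φ.To k i := by
  by_cases hk : k = i
  · subst hk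
    simp only [true_or, iff_true, InRange, Fin.le_def]
    have h1 := Φ.to_left_iff k (Φ.Fr k)
    have h2 := Φ.normal k (Φ.Fr k)
    have h3 : Φ.To k (Φ.Fr k) ↔ Φ.Fr k ≠ k := by simp [to_iff]
    have c1 := Fin.sub_val_cases k (Φ.Fl k)
    have c2 := Fin.sub_val_cases (Φ.Fr k) (Φ.Fl k)
    have c3 := Fin.sub_val_cases k (Φ.Fr k)
    have := k.isLt
    have := (Φ.Fl k).isLt
    have := (Φ.Fr k).isLt
    by_cases he : Φ.Fr k = k
    · rw [he]
    · have h4 : ¬ Φ.To (Φ.Fr k) k := fun e => h2 ⟨h3.mpr he, e⟩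
      rw [h1 he] at h4
      have : (Φ.Fr k).val ≠ k.val := fun e => he (Fin.ext e)
      omega
  · rw [Φ.to_left_iff i k hk, to_iff]
    simp only [InRange, Fin.le_def, hk, false_or, ne_eq, not_false_eq_true, true_and]
    have h1 := Φ.to_left_iff i (Φ.Fr i)
    have h2 := Φ.normal i (Φ.Fr i)
    have h3 : Φ.To i (Φ.Fr i) ↔ Φ.Fr i ≠ i := by simp [to_iff]
    have h5 : Φ.Fr i ≠ i → ¬ (i - Φ.Fr i).val ≤ (i - Φ.Fl i).val := fun he e =>
      h2 ⟨h3.mpr he, (h1 he).mpr e⟩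
    have h6 : Φ.Fr i ≠ i ↔ (Φ.Fr i).val ≠ i.val := by rw [ne_eq, Fin.ext_iff]
    rw [h6] at h5
    have c1 := Fin.sub_val_cases i (Φ.Fl i)
    have c2 := Fin.sub_val_cases (Φ.Fr i) (Φ.Fl i)
    have c3 := Fin.sub_val_cases i (Φ.Fr i)
    have c4 := Fin.sub_val_cases k (Φ.Fl i)
    have c5 := Fin.sub_val_cases k i
    have c6 := Fin.sub_val_cases i k
    have c7 := Fin.sub_val_cases (Φ.Fr i) i
    have := k.isLt
    have := i.isLt
    have := (Φ.Fl i).isLt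
    have := (Φ.Fr i).isLt
    have : k.val ≠ i.val := fun e => hk (Fin.ext e)
    omega

theorem represents_graph : Φ.Represents Φ.graph := by
  refine ⟨rfl, fun i => ?_⟩
  ext W
  simp only [SemiblockGraph.closedNbhd, Set.mem_ofPred_eq, graph_adj, Set.mem_image,
    inRange_far_iff]
  constructor
  · rintro (rfl | h | h)
    · exact ⟨i, Or.inl rfl, rfl⟩
    · obtain ⟨k, rfl⟩ := (Φ.arrow_mem h).2
      rw [arrow_block_iff] at h
      exact ⟨k, Or.inr (Or.inl h), rfl⟩
    · obtain ⟨k, rfl⟩ := (Φ.arrow_mem h).1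
      rw [arrow_block_iff] at h
      exact ⟨k, Or.inr (Or.inr h), rfl⟩
  · rintro ⟨k, h, rfl⟩
    simp only [arrow_block_iff]
    rcases h with rfl | h
    · exact Or.inl rfl
    · exact Or.inr h

theorem represents_iff {G : SemiblockGraph α} : Φ.Represents G ↔ Φ.graph = G := by
  constructor
  · rintro ⟨h1, h2⟩
    have hne : ∀ (G : SemiblockGraph α) B W, G.Adj B W → B ≠ W := by
      rintro G B _ ⟨hB, hW, h⟩ rfl
      exact h.ne rfl
    have key : ∀ (G : SemiblockGraph α) B W, G.Adj B W ↔ W ∈ G.closedNbhd B ∧ B ≠ W := by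
      intro G B W
      have h3 := hne G B W
      have h4 : W = B ↔ B = W := eq_comm
      simp only [SemiblockGraph.closedNbhd, Set.mem_ofPred_eq]
      tauto
    have h3 : Φ.graph.semiblocks = G.semiblocks := h1.symm
    refine SemiblockGraph.ext_adj h3 fun B W => ?_
    by_cases hB : B ∈ Φ.graph.semiblocks
    · obtain ⟨i, rfl⟩ := hB
      rw [key, key, h2 i, Φ.represents_graph.2 i]
    · have h4 : ¬ Φ.graph.Adj B W := fun e => hB e.1
      have h5 : ¬ G.Adj B W := fun e => hB (h3 ▸ e.1)
      simp [h4, h5]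
  · rintro rfl
    exact Φ.represents_graph

/-- The left end of a proper range is its only element with predecessor outside. The whole circle
has no such element, hence `hk`. -/
theorem inRange_injective {n : ℕ} {p q p' q' : Fin n}
    (h : ∀ k, InRange p q k ↔ InRange p' q' k) (hk : ∃ k, ¬ InRange p q k) : p = p' ∧ q = q' := by
  obtain ⟨k, hk⟩ := hk
  have hn : 0 < n := k.pos
  have hv : ∀ (p q k : Fin n), InRange p q k ↔ (k - p).val ≤ (q - p).val := fun _ _ _ => Iff.rfl
  simp only [hv] at h hk
  let r : Fin n := ⟨if p.val = 0 then n - 1 else p.val - 1, by split_ifs <;> omega⟩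
  have hr : r.val = if p.val = 0 then n - 1 else p.val - 1 := rfl
  clear_value r
  have h1 := h p
  have h2 := h r
  have c1 := Fin.sub_val_cases r p
  have c2 := Fin.sub_val_cases r p'
  have c3 := Fin.sub_val_cases p p
  have c4 := Fin.sub_val_cases p p'
  have c5 := Fin.sub_val_cases k p
  have := (q - p).isLt
  have := (q' - p').isLt
  have := (k - p).isLt
  have := p.isLt
  have := p'.isLt
  have hp : p.val = p'.val := by
    split_ifs at hr <;> omega
  have hp : p = p' := Fin.ext hp
  subst hp
  have h3 := (h q).mp le_rfl
  have h4 := (h q').mpr le_rfl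
  refine ⟨rfl, ?_⟩
  have := Fin.sub_val_cases q p
  have := Fin.sub_val_cases q' p
  have := q.isLt
  have := q'.isLt
  exact Fin.ext (by omega)

/-- Equal co-neighborhoods give equal ranges `[F_l, F_r]`; a co-neighbor shows that the range is
proper, so its ends are determined. -/
theorem indistinguishable_of_sameNbhd {i j : Fin Φ.n}
    (h : Twin Φ.graph.CoAdj (Φ.block i) (Φ.block j)) : Φ.Indistinguishable i j := by
  have key : ∀ i k, InRange (Φ.Fl i) (Φ.Fr i) k ↔ ¬ Φ.graph.CoAdj (Φ.block i) (Φ.block k) := by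
    intro i k
    rw [inRange_far_iff, coAdj_iff, arrow_block_iff, arrow_block_iff]
    have h1 : Φ.block i ≠ Φ.block k ↔ ¬ k = i := by
      rw [ne_eq, Φ.block_injective.eq_iff, eq_comm]
    have h2 : Φ.block i ∈ Φ.graph.semiblocks := ⟨i, rfl⟩
    have h3 : Φ.block k ∈ Φ.graph.semiblocks := ⟨k, rfl⟩
    tauto
  obtain ⟨⟨e, he⟩, hs⟩ := h
  refine inRange_injective (fun k => ?_) ?_
  · rw [key, key, hs]
  · obtain ⟨k, rfl⟩ := he.2.1
    exact ⟨k, fun h => (key i k).mp h he⟩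

/-- A list of semiblocks and a relation that is compatible with its circular order form a round
representation. -/
theorem exists_roundRep (L : List (Set α)) (hne : ∀ B ∈ L, B.Nonempty) (hnd : L.Nodup)
    (hdisj : ∀ B ∈ L, ∀ W ∈ L, B ≠ W → Disjoint B W) (R : Set α → Set α → Prop)
    (hmem : ∀ B W, R B W → B ∈ L ∧ W ∈ L) (hasymm : ∀ B W, R B W → ¬ R W B)
    (hcyc : ∀ i j k (hi : i < L.length) (hj : j < L.length) (hk : k < L.length), CycLt i k j →
      R L[i] L[j] → R L[i] L[k] ∧ R L[k] L[j]) :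
    ∃ Γ : RoundRep α, Γ.order = L ∧ ∀ B W, Γ.Arrow B W ↔ R B W := by
  classical
  have hirr : ∀ B, ¬ R B B := fun B h => hasymm _ _ h h
  -- The right far neighbor is the farthest target of an arrow from `i`, or `i` itself if there is
  -- none.
  have hex : ∀ i : Fin L.length, ∃ r : Fin L.length, (r = i ∨ R L[i] L[r]) ∧
      ∀ j : Fin L.length, R L[i] L[j] → (j - i).val ≤ (r - i).val := by
    intro i
    obtain ⟨r, hr, hmax⟩ := Finset.exists_max_image
      (Finset.univ.filter fun r : Fin L.length => r = i ∨ R L[i] L[r])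
      (fun r => (r - i).val) ⟨i, by simp⟩
    exact ⟨r, by simpa using hr, fun j hj =>
      hmax j (Finset.mem_filter.mpr ⟨Finset.mem_univ _, Or.inr hj⟩)⟩
  choose F hF1 hF2 using hex
  have hto : ∀ i j : Fin L.length, (j ≠ i ∧ InRange i (F i) j) ↔ R L[i] L[j] := by
    intro i j
    constructor
    · rintro ⟨h1, h2⟩
      have h2 : (j - i).val ≤ (F i - i).val := h2
      rcases hF1 i with h3 | h3
      · rw [h3] at h2
        have c1 := Fin.sub_val_cases j i
        have c2 := Fin.sub_val_cases i i
        have : j.val ≠ i.val := fun e => h1 (Fin.ext e)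
        have := i.isLt
        have := j.isLt
        omega
      · by_cases h4 : j = F i
        · rwa [h4]
        · refine (hcyc i (F i) j i.isLt (F i).isLt j.isLt ?_ h3).1
          have c1 := Fin.sub_val_cases j i
          have c2 := Fin.sub_val_cases (F i) i
          have : j.val ≠ i.val := fun e => h1 (Fin.ext e)
          have : j.val ≠ (F i).val := fun e => h4 (Fin.ext e)
          have := i.isLt
          have := j.isLt
          unfold CycLt
          omega
    · intro h
      refine ⟨?_, hF2 i j h⟩
      rintro rfl
      exact hirr _ h
  let Γ : RoundRep α :=
    { n := L.length
      block := fun i => L[i]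
      nonempty := fun i => hne _ (List.getElem_mem _)
      disjoint := fun i j hij => hdisj _ (List.getElem_mem _) _ (List.getElem_mem _)
        fun e => hij (Fin.ext (hnd.getElem_inj_iff.mp e))
      Fr := F
      round := by
        intro i
        show (F i - i).val ≤ (F (finRotate _ i) - i).val
        have h0 : (i - i).val = 0 := by
          have := Fin.sub_val_cases i i
          omega
        rcases hF1 i with h1 | h1
        · rw [h1, h0]
          exact Nat.zero_le _
        have hFi : F i ≠ i := fun e => hirr _ (e ▸ h1)
        have c1 := sub_val_of_rotate i (F i) hFi.symm
        have c2 : ∀ t, t ≠ i → (t - finRotate L.length i).val + 1 = (t - i).val :=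
          fun t ht => sub_val_of_rotate i t ht.symm
        have hsi : finRotate L.length i ≠ i := fun e => by
          rw [e] at c1
          omega
        generalize finRotate L.length i = s at c1 c2 hsi ⊢
        have c3 := c2 s hsi
        have c4 := Fin.sub_val_cases s s
        -- The arrow from `i` to `F i` passes over the successor `s`, so `F s` reaches at least as
        -- far.
        have hR : F i = s ∨ (R L[i] L[s] ∧ R L[s] L[F i]) := by
          by_cases h2 : F i = s
          · exact Or.inl h2
          refine Or.inr (hcyc i (F i) s i.isLt (F i).isLt s.isLt ?_ h1)
          have c5 := Fin.sub_val_cases s i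
          have c6 := Fin.sub_val_cases (F i) i
          have : (F i).val ≠ s.val := fun e => h2 (Fin.ext e)
          have : (F i).val ≠ i.val := fun e => hFi (Fin.ext e)
          have : s.val ≠ i.val := fun e => hsi (Fin.ext e)
          have := i.isLt
          have := (F i).isLt
          have := s.isLt
          unfold CycLt
          omega
        have his : R L[i] L[s] := hR.elim (fun e => e ▸ h1) And.left
        -- Only at `i` would the distance from `i` drop back to zero, and `s → i` would oppose `i →
        -- s`.
        have hFs : F s ≠ i := by
          intro e
          rcases hF1 s with h3 | h3
          · exact hsi (h3.symm.trans e)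
          · rw [e] at h3
            exact hasymm _ _ his h3
        have c7 := c2 _ hFs
        rcases hR with h2 | h2
        · rw [h2, ← c3]
          omega
        · have := hF2 s (F i) h2.2
          omega
      normal := by
        rintro i j ⟨h1, h2⟩
        exact hasymm _ _ ((hto i j).mp h1) ((hto j i).mp h2) }
  refine ⟨Γ, List.ofFn_getElem, fun B W => ?_⟩
  constructor
  · rintro ⟨i, j, rfl, rfl, h⟩
    exact (hto i j).mp h
  · intro h
    obtain ⟨hB, hW⟩ := hmem _ _ h
    obtain ⟨i, hi, rfl⟩ := List.getElem_of_mem hB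
    obtain ⟨j, hj, rfl⟩ := List.getElem_of_mem hW
    exact ⟨⟨i, hi⟩, ⟨j, hj⟩, rfl, rfl, (hto ⟨i, hi⟩ ⟨j, hj⟩).mpr h⟩

/-- Indistinguishable semiblocks may be exchanged position by position. -/
theorem exists_equal (L : List (Set α)) (hL : L.Perm Φ.order)
    (h : ∀ i (hi : i < L.length) (hi' : i < Φ.order.length),
      L[i] = Φ.order[i] ∨ Twin Φ.graph.CoAdj L[i] Φ.order[i]) :
    ∃ Γ : RoundRep α, Φ.Equal Γ ∧ Γ.order = L ∧
      ∀ i j (hi : i < L.length) (hj : j < L.length) (hi' : i < Φ.order.length)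
        (hj' : j < Φ.order.length), Γ.Arrow L[i] L[j] ↔ Φ.Arrow Φ.order[i] Φ.order[j] := by
  have hlen : L.length = Φ.n := by rw [hL.length_eq, order_length]
  have hnd : L.Nodup := hL.nodup_iff.mpr Φ.order_nodup
  have hex : ∀ i : Fin Φ.n, ∃ j, Φ.block j = L[i] := by
    intro i
    have : L[i] ∈ Φ.graph.semiblocks := by
      rw [← mem_order, ← hL.mem_iff]
      exact List.getElem_mem _
    exact this
  choose f hf using hex
  have hinj : Function.Injective f := by
    intro i j hij
    have := (hf i).symm.trans (hij ▸ hf j)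
    exact Fin.ext (hnd.getElem_inj_iff.mp this)
  let σ : Equiv.Perm (Fin Φ.n) := Equiv.ofBijective f (Finite.injective_iff_bijective.mp hinj)
  have hσ : ∀ i, Φ.block (σ i) = L[i] := hf
  have horder : (Φ.permute σ).order = L := by
    refine List.ext_getElem (by rw [order_length, hlen]; rfl) fun i h1 h2 => ?_
    rw [order_getElem]
    exact hσ ⟨i, by omega⟩
  refine ⟨Φ.permute σ, ⟨σ, fun i => ?_, rfl⟩, horder, ?_⟩
  · have h1 := h i (by omega) (by rw [order_length]; omega)
    rw [order_getElem] at h1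
    rcases h1 with h1 | h1
    · have : i = σ i := Φ.block_injective (h1.symm.trans (hσ i).symm)
      rw [← this]
      exact ⟨rfl, rfl⟩
    · refine Φ.indistinguishable_of_sameNbhd ?_
      rw [hσ i]
      exact h1.symm
  · intro i j hi hj hi' hj'
    rw [order_getElem, order_getElem, arrow_block_iff]
    have e1 : L[i] = (Φ.permute σ).block ⟨i, by rwa [order_length] at hi'⟩ :=
      (hσ ⟨i, _⟩).symm
    have e2 : L[j] = (Φ.permute σ).block ⟨j, by rwa [order_length] at hj'⟩ :=
      (hσ ⟨j, _⟩).symm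
    rw [e1, e2, arrow_block_iff]
    rfl

/-- Membership of `j` in `[F_l i, F_r i]` does not change when `i` is replaced by `σ i`; by symmetry
the same holds for `j`. -/
theorem Equal.graph_eq {Φ Γ : RoundRep α} (h : Φ.Equal Γ) : Γ.graph = Φ.graph := by
  obtain ⟨σ, hσ, rfl⟩ := h
  have hs : (Φ.permute σ).graph.semiblocks = Φ.graph.semiblocks :=
    σ.surjective.range_comp Φ.block
  refine SemiblockGraph.ext_adj hs fun B W => ?_
  by_cases hB : B ∈ Φ.graph.semiblocks ∧ W ∈ Φ.graph.semiblocks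
  · obtain ⟨⟨i, rfl⟩, ⟨j, rfl⟩⟩ := hB
    obtain ⟨i, rfl⟩ := σ.surjective i
    obtain ⟨j, rfl⟩ := σ.surjective j
    have e : ∀ i j, (Φ.permute σ).Arrow (Φ.block (σ i)) (Φ.block (σ j)) ↔ Φ.To i j :=
      fun i j => (Φ.permute σ).arrow_block_iff i j
    rw [graph_adj, graph_adj, arrow_block_iff, arrow_block_iff, e, e]
    have key : ∀ i j : Fin Φ.n, InRange (Φ.Fl (σ i)) (Φ.Fr (σ i)) j ↔
        InRange (Φ.Fl i) (Φ.Fr i) j := fun i j => by rw [(hσ i).1, (hσ i).2]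
    have hsymm : ∀ i j : Fin Φ.n, InRange (Φ.Fl i) (Φ.Fr i) j ↔ InRange (Φ.Fl j) (Φ.Fr j) i := by
      intro i j
      rw [inRange_far_iff, inRange_far_iff, eq_comm (a := j), or_comm (a := Φ.To i j)]
    have h1 : InRange (Φ.Fl (σ i)) (Φ.Fr (σ i)) (σ j) ↔ InRange (Φ.Fl i) (Φ.Fr i) j := by
      rw [key, hsymm, key, hsymm]
    rw [inRange_far_iff, inRange_far_iff, σ.injective.eq_iff] at h1
    by_cases hij : j = i
    · subst hij
      simp [to_iff]
    · simpa [hij] using h1.symm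
  · have h1 : ¬ Φ.graph.Adj B W := fun e => hB ⟨e.1, e.2.1⟩
    have h2 : ¬ (Φ.permute σ).graph.Adj B W := fun e => hB (hs ▸ ⟨e.1, e.2.1⟩)
    simp [h1, h2]

end RoundRep

/-! ### From sided orders back to round representations. -/

/-- The colours and the cyclic position leave finitely many cases. For instance, with `a`, `c` of
colour `true` and `b` of colour `false`, an arrow `a → b` means `b < a`; if `c` follows `a`, then `b
< a < c`, which gives `a → c → b`. -/
theorem SidedOrder.twist_between {β : Type*} {S : Set β} {H lt : β → β → Prop} {side : β → Bool}
    (h : SidedOrder S H lt side) {L : List β} (hL : L.Pairwise (SidedBefore side lt)) {i j k : ℕ}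
    (hi : i < L.length) (hj : j < L.length) (hk : k < L.length) (hc : CycLt i k j)
    (hij : twist side lt L[i] L[j]) : twist side lt L[i] L[k] ∧ twist side lt L[k] L[j] := by
  rw [List.pairwise_iff_getElem] at hL
  have h1 := hL i j hi hj
  have h2 := hL j i hj hi
  have h3 := hL i k hi hk
  have h4 := hL k i hk hi
  have h5 := hL k j hk hj
  have h6 := hL j k hj hk
  have ht := h.trans
  have ha := h.asymm
  generalize L[i] = a at *
  generalize L[j] = b at *
  generalize L[k] = c at *
  unfold CycLt at hc
  unfold SidedBefore at h1 h2 h3 h4 h5 h6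
  unfold twist at *
  clear hL hi hj hk h
  cases sa : side a <;> cases sb : side b <;> cases sc : side c <;>
    simp only [sa, sb, sc, reduceCtorEq, ne_eq, not_true_eq_false, not_false_eq_true, and_true,
      true_and, false_and, and_false, or_false, false_or, and_self, or_self,
      imp_false, not_lt] at * <;>
    rcases hc with hc | hc | hc <;> first | omega | grind

theorem IncOrder.restrict {β : Type*} {S T : Set β} {H lt : β → β → Prop} (h : IncOrder S H lt)
    (hTS : T ⊆ S) (hT : ∀ a b, H a b → a ∈ T → b ∈ T) :
    IncOrder T H (fun a b => a ∈ T ∧ b ∈ T ∧ lt a b) where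
  mem a b hab := ⟨hab.1, hab.2.1⟩
  asymm a b hab hba := h.asymm _ _ hab.2.2 hba.2.2
  tri a b ha hb hab := by
    have := h.tri a b (hTS ha) (hTS hb) hab
    tauto
  symm := h.symm
  not_inc a b hab := h.not_inc _ _ hab.2.2
  left a b c hab hac :=
    (h.left _ _ _ hab.2.2 hac).imp_left fun e => ⟨hT _ _ hac hab.1, hab.2.1, e⟩
  right a b c hab hbc :=
    (h.right _ _ _ hab.2.2 hbc).imp_left fun e => ⟨hab.1, hT _ _ hbc hab.2.1, e⟩

theorem SemiblockGraph.adj_iff {α : Type*} (G : SemiblockGraph α) {B W : Set α} :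
    G.Adj B W ↔ B ∈ G.semiblocks ∧ W ∈ G.semiblocks ∧ B ≠ W ∧ ¬ G.CoAdj B W := by
  have h1 : G.Adj B W → B ∈ G.semiblocks ∧ W ∈ G.semiblocks ∧ B ≠ W := by
    rintro ⟨hB, hW, h⟩
    exact ⟨hB, hW, fun e => h.ne (Subtype.ext e)⟩
  unfold SemiblockGraph.CoAdj
  tauto

/-- A round representation whose relation is the twist of a sided order represents the graph
whose non-edges are not oriented by that order. -/
theorem RoundRep.graph_eq_of_arrow {α : Type*} {G : SemiblockGraph α} {lt : Set α → Set α → Prop}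
    {side : Set α → Bool} (h : IncOrder G.semiblocks G.CoAdj lt) (Γ : RoundRep α)
    (hs : Γ.graph.semiblocks = G.semiblocks)
    (harr : ∀ B W, Γ.Arrow B W ↔ twist side lt B W) : Γ.graph = G := by
  refine SemiblockGraph.ext_adj hs fun B W => ?_
  rw [Γ.graph_adj, G.adj_iff, harr, harr]
  have h1 : twist side lt B W ∨ twist side lt W B ↔ lt B W ∨ lt W B := by
    unfold twist
    grind
  rw [h1]
  constructor
  · rintro (e | e)
    · exact ⟨(h.mem _ _ e).1, (h.mem _ _ e).2, by rintro rfl; exact h.irrefl _ e, h.not_inc _ _ e⟩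
    · exact ⟨(h.mem _ _ e).2, (h.mem _ _ e).1, by rintro rfl; exact h.irrefl _ e,
        fun e' => h.not_inc _ _ e (h.symm _ _ e')⟩
  · rintro ⟨h2, h3, h4, h5⟩
    have := h.tri B W h2 h3 h4
    tauto

/-! ### Orderings of co-contigs that describe a graph. -/

namespace CoContigOrdering

variable {α : Type*} (𝔹 : CoContigOrdering α)

/-- The semiblocks of the `i`-th co-contig. -/
def support (i : Fin 𝔹.s) : Set (Set α) := {B | B ∈ 𝔹.X (Sum.inl i) ∨ B ∈ 𝔹.X (Sum.inr i)}

open Classical in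
/-- Whether a semiblock lies in one of the first `s` ranges. -/
noncomputable def side (B : Set α) : Bool := decide (∃ i, B ∈ 𝔹.X (Sum.inl i))

/-- The relation of the `i`-th co-contig, reversed on pairs from different ranges. -/
def localLt (i : Fin 𝔹.s) (B W : Set α) : Prop :=
  ∃ p q, coContigIndex p = i ∧ coContigIndex q = i ∧ B ∈ 𝔹.X p ∧ W ∈ 𝔹.X q ∧
    ((p = q ∧ 𝔹.arrow i B W) ∨ (p ≠ q ∧ 𝔹.arrow i W B))

/-- The sum of the relations `localLt` over the co-contigs. -/
def Lt (B W : Set α) : Prop :=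
  ∃ i j, B ∈ 𝔹.support i ∧ W ∈ 𝔹.support j ∧ (i < j ∨ (i = j ∧ 𝔹.localLt i B W))

/-- `𝔹` consists of the co-components of `G`, each with a transitive orientation that sorts its
two ranges. -/
structure Describes (G : SemiblockGraph α) : Prop where
  nodup : ∀ p, (𝔹.X p).Nodup
  unique : ∀ p q B, B ∈ 𝔹.X p → B ∈ 𝔹.X q → p = q
  mem_iff : ∀ B, B ∈ G.semiblocks ↔ ∃ p, B ∈ 𝔹.X p
  comp : ∀ i, G.IsCoComponent (𝔹.support i)
  clique : ∀ p B W, B ∈ 𝔹.X p → W ∈ 𝔹.X p → ¬ G.CoAdj B W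
  arrow_mem : ∀ i B W, 𝔹.arrow i B W → B ∈ 𝔹.support i ∧ W ∈ 𝔹.support i
  local_order : ∀ i, IncOrder (𝔹.support i) G.CoAdj (𝔹.localLt i)
  local_trans : ∀ i B W V, 𝔹.localLt i B W → 𝔹.localLt i W V → 𝔹.localLt i B V
  sorted : ∀ p, (𝔹.X p).Pairwise (𝔹.arrow (coContigIndex p))

variable {𝔹}

theorem mem_support {i : Fin 𝔹.s} {B : Set α} :
    B ∈ 𝔹.support i ↔ ∃ p, coContigIndex p = i ∧ B ∈ 𝔹.X p := by
  constructor
  · rintro (h | h)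
    · exact ⟨_, rfl, h⟩
    · exact ⟨_, rfl, h⟩
  · rintro ⟨p | p, rfl, h⟩
    · exact Or.inl h
    · exact Or.inr h

theorem eq_iff_isLeft_eq {s : ℕ} {p q : Fin s ⊕ Fin s} (h : coContigIndex p = coContigIndex q) :
    p = q ↔ p.isLeft = q.isLeft := by
  rcases p with p | p <;> rcases q with q | q <;> simp_all [coContigIndex]

theorem side_eq (hu : ∀ p q B, B ∈ 𝔹.X p → B ∈ 𝔹.X q → p = q) {p : Fin 𝔹.s ⊕ Fin 𝔹.s}
    {B : Set α} (h : B ∈ 𝔹.X p) : 𝔹.side B = p.isLeft := by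
  unfold side
  rcases p with p | p
  · simpa using ⟨p, h⟩
  · simp only [Sum.isLeft_inr, decide_eq_false_iff_not, not_exists]
    intro i hi
    have := hu _ _ _ h hi
    simp at this

theorem support_unique (hu : ∀ p q B, B ∈ 𝔹.X p → B ∈ 𝔹.X q → p = q) {i j : Fin 𝔹.s} {B : Set α}
    (hi : B ∈ 𝔹.support i) (hj : B ∈ 𝔹.support j) : i = j := by
  obtain ⟨p, rfl, hp⟩ := mem_support.mp hi
  obtain ⟨q, rfl, hq⟩ := mem_support.mp hj
  rw [hu _ _ _ hp hq]

theorem path_of_isCoComponent {G : SemiblockGraph α} {C : Set (Set α)} (h : G.IsCoComponent C)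
    {B W : Set α} (hB : B ∈ C) (hW : W ∈ C) : Relation.ReflTransGen G.CoAdj B W := by
  obtain ⟨V, _, rfl⟩ := G.isCoComponent_iff.mp h
  have hs : ∀ a b, Relation.ReflTransGen G.CoAdj a b → Relation.ReflTransGen G.CoAdj b a := by
    intro a b hab
    induction hab with
    | refl => exact .refl
    | tail _ hbc ih => exact .head (G.coAdj_symm hbc) ih
  exact (hs _ _ hB).trans hW

theorem mem_of_isCoComponent {G : SemiblockGraph α} {C : Set (Set α)} (h : G.IsCoComponent C)
    {B W : Set α} (hBW : G.CoAdj B W) (hB : B ∈ C) : W ∈ C := by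
  obtain ⟨V, _, rfl⟩ := G.isCoComponent_iff.mp h
  exact Relation.ReflTransGen.tail hB hBW

theorem mem_concat {B : Set α} : B ∈ 𝔹.concat ↔ ∃ p, B ∈ 𝔹.X p := by
  simp only [concat, List.mem_append, List.mem_flatten, List.mem_ofFn, Sum.exists]
  constructor
  · rintro (⟨_, ⟨i, rfl⟩, h⟩ | ⟨_, ⟨i, rfl⟩, h⟩)
    · exact Or.inl ⟨i, h⟩
    · exact Or.inr ⟨i, h⟩
  · rintro (⟨i, h⟩ | ⟨i, h⟩)
    · exact Or.inl ⟨_, ⟨i, rfl⟩, h⟩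
    · exact Or.inr ⟨_, ⟨i, rfl⟩, h⟩

theorem concat_pairwise_iff {R : Set α → Set α → Prop} : 𝔹.concat.Pairwise R ↔
    (∀ p, (𝔹.X p).Pairwise R) ∧
      (∀ i j, i < j → ∀ B ∈ 𝔹.X (Sum.inl i), ∀ W ∈ 𝔹.X (Sum.inl j), R B W) ∧
      (∀ i j, i < j → ∀ B ∈ 𝔹.X (Sum.inr i), ∀ W ∈ 𝔹.X (Sum.inr j), R B W) ∧
      ∀ i j, ∀ B ∈ 𝔹.X (Sum.inl i), ∀ W ∈ 𝔹.X (Sum.inr j), R B W := by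
  have h1 : ∀ f : Fin 𝔹.s → List (Set α), (∀ l ∈ List.ofFn f, l.Pairwise R) ↔
      ∀ i, (f i).Pairwise R := by
    intro f
    simp [List.mem_ofFn]
  simp only [concat, List.pairwise_append, List.pairwise_flatten, h1]
  simp only [List.pairwise_ofFn, Sum.forall, List.mem_flatten, List.mem_ofFn]
  constructor
  · rintro ⟨⟨a1, a2⟩, ⟨a3, a4⟩, a5⟩
    exact ⟨⟨a1, a3⟩, a2, a4, fun i j B hB W hW => a5 B ⟨_, ⟨i, rfl⟩, hB⟩ W ⟨_, ⟨j, rfl⟩, hW⟩⟩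
  · rintro ⟨⟨a1, a3⟩, a2, a4, a5⟩
    refine ⟨⟨a1, a2⟩, ⟨a3, a4⟩, ?_⟩
    rintro B ⟨_, ⟨i, rfl⟩, hB⟩ W ⟨_, ⟨j, rfl⟩, hW⟩
    exact a5 i j B hB W hW

theorem concat_split (p : Fin 𝔹.s ⊕ Fin 𝔹.s) : ∃ L₁ L₂, 𝔹.concat = L₁ ++ 𝔹.X p ++ L₂ := by
  have h1 : ∀ (f : Fin 𝔹.s → List (Set α)) i, ∃ L₁ L₂, (List.ofFn f).flatten = L₁ ++ f i ++ L₂ := by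
    intro f i
    obtain ⟨s, t, hst⟩ := List.append_of_mem (List.mem_ofFn.mpr ⟨i, rfl⟩ : f i ∈ List.ofFn f)
    exact ⟨s.flatten, t.flatten, by simp [hst]⟩
  rcases p with p | p
  · obtain ⟨s, t, h⟩ := h1 (fun i => 𝔹.X (Sum.inl i)) p
    exact ⟨s, t ++ (List.ofFn fun i => 𝔹.X (Sum.inr i)).flatten, by simp [concat, h]⟩
  · obtain ⟨s, t, h⟩ := h1 (fun i => 𝔹.X (Sum.inr i)) p
    exact ⟨(List.ofFn fun i => 𝔹.X (Sum.inl i)).flatten ++ s, t, by simp [concat, h]⟩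

theorem localLt_iff (hu : ∀ p q B, B ∈ 𝔹.X p → B ∈ 𝔹.X q → p = q) {i : Fin 𝔹.s} {B W : Set α} :
    𝔹.localLt i B W ↔ B ∈ 𝔹.support i ∧ W ∈ 𝔹.support i ∧ twist 𝔹.side (𝔹.arrow i) B W := by
  constructor
  · rintro ⟨p, q, hp, hq, hB, hW, h⟩
    refine ⟨mem_support.mpr ⟨p, hp, hB⟩, mem_support.mpr ⟨q, hq, hW⟩, ?_⟩
    rw [eq_iff_isLeft_eq (hp.trans hq.symm), ne_eq, eq_iff_isLeft_eq (hp.trans hq.symm)] at h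
    rwa [twist, side_eq hu hB, side_eq hu hW]
  · rintro ⟨h1, h2, h⟩
    obtain ⟨p, hp, hB⟩ := mem_support.mp h1
    obtain ⟨q, hq, hW⟩ := mem_support.mp h2
    refine ⟨p, q, hp, hq, hB, hW, ?_⟩
    rw [eq_iff_isLeft_eq (hp.trans hq.symm), ne_eq, eq_iff_isLeft_eq (hp.trans hq.symm)]
    rwa [twist, side_eq hu hB, side_eq hu hW] at h

theorem lt_iff_local (hu : ∀ p q B, B ∈ 𝔹.X p → B ∈ 𝔹.X q → p = q) {i : Fin 𝔹.s} {B W : Set α}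
    (hB : B ∈ 𝔹.support i) (hW : W ∈ 𝔹.support i) : 𝔹.Lt B W ↔ 𝔹.localLt i B W := by
  constructor
  · rintro ⟨j, k, h1, h2, h⟩
    obtain rfl := support_unique hu hB h1
    obtain rfl := support_unique hu hW h2
    simpa using h
  · exact fun h => ⟨i, i, hB, hW, Or.inr ⟨rfl, h⟩⟩

theorem lt_iff_index (hu : ∀ p q B, B ∈ 𝔹.X p → B ∈ 𝔹.X q → p = q) {i j : Fin 𝔹.s} {B W : Set α}
    (hB : B ∈ 𝔹.support i) (hW : W ∈ 𝔹.support j) (hij : i ≠ j) : 𝔹.Lt B W ↔ i < j := by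
  constructor
  · rintro ⟨k, l, h1, h2, h⟩
    obtain rfl := support_unique hu hB h1
    obtain rfl := support_unique hu hW h2
    tauto
  · exact fun h => ⟨i, j, hB, hW, Or.inl h⟩

theorem concat_nodup_iff : 𝔹.concat.Nodup ↔
    (∀ p, (𝔹.X p).Nodup) ∧ ∀ p q B, B ∈ 𝔹.X p → B ∈ 𝔹.X q → p = q := by
  have hne : ∀ (L M : List (Set α)), (∀ B ∈ L, ∀ W ∈ M, B ≠ W) ↔ ∀ B, B ∈ L → B ∉ M := by
    intro L M
    exact ⟨fun h B hB hM => h B hB B hM rfl, fun h B hB W hW e => h B hB (e ▸ hW)⟩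
  unfold List.Nodup
  rw [concat_pairwise_iff]
  simp only [hne]
  refine and_congr_right fun _ => ?_
  constructor
  · rintro ⟨h1, h2, h3⟩ (i | i) (j | j) B hi hj
    · rcases lt_trichotomy i j with h | h | h
      · exact (h1 _ _ h B hi hj).elim
      · rw [h]
      · exact (h1 _ _ h B hj hi).elim
    · exact (h3 _ _ B hi hj).elim
    · exact (h3 _ _ B hj hi).elim
    · rcases lt_trichotomy i j with h | h | h
      · exact (h2 _ _ h B hi hj).elim
      · rw [h]
      · exact (h2 _ _ h B hj hi).elim
  · intro h
    refine ⟨fun i j hij B hi hj => ?_, fun i j hij B hi hj => ?_, fun i j B hi hj => ?_⟩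
    · exact hij.ne (Sum.inl_injective (h _ _ B hi hj))
    · exact hij.ne (Sum.inr_injective (h _ _ B hi hj))
    · exact Sum.inl_ne_inr (h _ _ B hi hj)

namespace Describes

variable {G : SemiblockGraph α}

theorem mem_semiblocks_iff (h : 𝔹.Describes G) {B : Set α} :
    B ∈ G.semiblocks ↔ ∃ i, B ∈ 𝔹.support i := by
  rw [h.mem_iff]
  constructor
  · rintro ⟨p, hp⟩
    exact ⟨_, mem_support.mpr ⟨p, rfl, hp⟩⟩
  · rintro ⟨i, hi⟩
    obtain ⟨p, _, hp⟩ := mem_support.mp hi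
    exact ⟨p, hp⟩

theorem concat_nodup (h : 𝔹.Describes G) : 𝔹.concat.Nodup :=
  concat_nodup_iff.mpr ⟨h.nodup, h.unique⟩

theorem mem_concat_iff (h : 𝔹.Describes G) {B : Set α} : B ∈ 𝔹.concat ↔ B ∈ G.semiblocks :=
  mem_concat.trans (h.mem_iff B).symm

/-- `Lt` is an ordinal sum of the local orders; `H` never joins different summands, since these are
co-components. -/
theorem sidedOrder (h : 𝔹.Describes G) : SidedOrder G.semiblocks G.CoAdj 𝔹.Lt 𝔹.side where
  mem B W := by
    rintro ⟨i, j, hB, hW, _⟩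
    exact ⟨h.mem_semiblocks_iff.mpr ⟨i, hB⟩, h.mem_semiblocks_iff.mpr ⟨j, hW⟩⟩
  asymm B W := by
    rintro ⟨i, j, hB, hW, h1⟩ h2
    by_cases hij : i = j
    · subst hij
      rw [lt_iff_local h.unique hW hB] at h2
      exact (h.local_order i).asymm _ _ h2 (by simpa using h1)
    · rw [lt_iff_index h.unique hW hB (Ne.symm hij)] at h2
      rcases h1 with h1 | h1
      · exact lt_asymm h1 h2
      · exact hij h1.1
  tri B W hB hW hBW := by
    obtain ⟨i, hi⟩ := h.mem_semiblocks_iff.mp hB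
    obtain ⟨j, hj⟩ := h.mem_semiblocks_iff.mp hW
    by_cases hij : i = j
    · subst hij
      rw [lt_iff_local h.unique hi hj, lt_iff_local h.unique hj hi]
      exact (h.local_order i).tri B W hi hj hBW
    · rw [lt_iff_index h.unique hi hj hij, lt_iff_index h.unique hj hi (Ne.symm hij)]
      omega
  symm _ _ := G.coAdj_symm
  not_inc B W := by
    rintro ⟨i, j, hB, hW, h1⟩ h2
    obtain rfl := support_unique h.unique (mem_of_isCoComponent (h.comp i) h2 hB) hW
    exact (h.local_order i).not_inc B W (by simpa using h1) h2
  left B W V := by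
    rintro ⟨i, j, hB, hW, h1⟩ h2
    have hV := mem_of_isCoComponent (h.comp i) h2 hB
    rcases h1 with h1 | ⟨rfl, h1⟩
    · exact Or.inl ⟨i, j, hV, hW, Or.inl h1⟩
    · rw [lt_iff_local h.unique hV hW]
      exact (h.local_order i).left _ _ _ h1 h2
  right B W V := by
    rintro ⟨i, j, hB, hW, h1⟩ h2
    have hV := mem_of_isCoComponent (h.comp j) h2 hW
    rcases h1 with h1 | ⟨rfl, h1⟩
    · exact Or.inl ⟨i, j, hB, hV, Or.inl h1⟩
    · rw [lt_iff_local h.unique hB hV]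
      exact (h.local_order i).right _ _ _ h1 h2
  inc_mem B W hBW := ⟨hBW.1, hBW.2.1⟩
  proper B W hBW := by
    obtain ⟨i, hi⟩ := h.mem_semiblocks_iff.mp hBW.1
    have hj := mem_of_isCoComponent (h.comp i) hBW hi
    obtain ⟨p, hp, hB⟩ := mem_support.mp hi
    obtain ⟨q, hq, hW⟩ := mem_support.mp hj
    rw [side_eq h.unique hB, side_eq h.unique hW, ne_eq,
      ← eq_iff_isLeft_eq (hp.trans hq.symm)]
    rintro rfl
    exact h.clique _ _ _ hB hW hBW
  trans B W V := by
    rintro ⟨i, j, hB, hW, h1⟩ ⟨j', k, hW', hV, h2⟩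
    obtain rfl := support_unique h.unique hW hW'
    refine ⟨i, k, hB, hV, ?_⟩
    rcases h1 with h1 | ⟨rfl, h1⟩
    · rcases h2 with h2 | ⟨rfl, h2⟩
      · exact Or.inl (h1.trans h2)
      · exact Or.inl h1
    · rcases h2 with h2 | ⟨rfl, h2⟩
      · exact Or.inl h2
      · exact Or.inr ⟨rfl, h.local_trans _ _ _ _ h1 h2⟩

theorem arrow_iff (h : 𝔹.Describes G) {i : Fin 𝔹.s} {B W : Set α} (hB : B ∈ 𝔹.support i)
    (hW : W ∈ 𝔹.support i) : 𝔹.arrow i B W ↔ twist 𝔹.side 𝔹.Lt B W := by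
  rw [← twist_twist 𝔹.side (𝔹.arrow i)]
  simp only [twist, lt_iff_local h.unique hB hW, lt_iff_local h.unique hW hB,
    localLt_iff h.unique, hB, hW, true_and]

theorem concat_sorted (h : 𝔹.Describes G) :
    𝔹.concat.Pairwise (SidedBefore 𝔹.side 𝔹.Lt) := by
  rw [concat_pairwise_iff]
  have hs : ∀ {p B}, B ∈ 𝔹.X p → B ∈ 𝔹.support (coContigIndex p) :=
    fun {p B} hB => mem_support.mpr ⟨p, rfl, hB⟩
  refine ⟨fun p => ?_, fun i j hij B hB W hW => ?_, fun i j hij B hB W hW => ?_,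
    fun i j B hB W hW => ?_⟩
  · refine (h.sorted p).imp_of_mem fun {B W} hB hW hBW => Or.inr ?_
    have e : 𝔹.side B = 𝔹.side W := by rw [side_eq h.unique hB, side_eq h.unique hW]
    rw [h.arrow_iff (hs hB) (hs hW)] at hBW
    exact ⟨e, by simpa [twist, e] using hBW⟩
  · exact Or.inr ⟨by rw [side_eq h.unique hB, side_eq h.unique hW]; rfl,
      _, _, hs hB, hs hW, Or.inl hij⟩
  · exact Or.inr ⟨by rw [side_eq h.unique hB, side_eq h.unique hW]; rfl,
      _, _, hs hB, hs hW, Or.inl hij⟩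
  · exact Or.inl ⟨by rw [side_eq h.unique hB]; rfl, by rw [side_eq h.unique hW]; rfl⟩

/-- An ordering that describes the graph of `Γ` is a natural ordering of `Γ` if `Γ` has its circular
ordering and its relation. -/
theorem isNaturalOrdering {Γ : RoundRep α} (h : 𝔹.Describes Γ.graph)
    (hc : 𝔹.concat ~r Γ.order) (harr : ∀ B W, Γ.Arrow B W ↔ twist 𝔹.side 𝔹.Lt B W) :
    Γ.IsNaturalOrdering 𝔹 := by
  have hs : ∀ {p B}, B ∈ 𝔹.X p → B ∈ 𝔹.support (coContigIndex p) :=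
    fun {p B} hB => mem_support.mpr ⟨p, rfl, hB⟩
  have hrange : ∀ p, Γ.IsRange (𝔹.X p) := by
    intro p
    obtain ⟨L₁, L₂, hL⟩ := concat_split p
    refine ⟨L₂ ++ L₁, List.IsRotated.trans ?_ hc⟩
    rw [hL, ← List.append_assoc, List.append_assoc L₁]
    exact List.isRotated_append
  have hclique : ∀ p, Γ.graph.IsCliqueFamily {B | B ∈ 𝔹.X p} := by
    intro p B hB W hW hne
    exact Γ.graph.adj_iff.mpr ⟨(h.mem_iff B).mpr ⟨p, hB⟩, (h.mem_iff W).mpr ⟨p, hW⟩, hne,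
      h.clique p B W hB hW⟩
  have hplace : ∀ p q, coContigIndex p < coContigIndex q → ∀ B ∈ 𝔹.X p, ∀ W ∈ 𝔹.X q,
      (p.isLeft = q.isLeft → Γ.Arrow B W) ∧ (p.isLeft ≠ q.isLeft → Γ.Arrow W B) := by
    intro p q hpq B hB W hW
    have h1 : 𝔹.Lt B W := ⟨_, _, hs hB, hs hW, Or.inl hpq⟩
    rw [harr, harr, twist, twist, side_eq h.unique hB, side_eq h.unique hW]
    exact ⟨fun e => Or.inl ⟨e, h1⟩, fun e => Or.inr ⟨Ne.symm e, h1⟩⟩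
  refine ⟨fun i => ⟨hrange _, hrange _, ?_, h.comp i, hclique _, hclique _⟩, ?_, hc, ?_⟩
  · intro B hB hW
    exact Sum.inl_ne_inr (h.unique _ _ B hB hW)
  · intro i B W
    rw [harr]
    constructor
    · intro hBW
      have h1 := h.arrow_mem i B W hBW
      exact ⟨h1.1, h1.2, (h.arrow_iff h1.1 h1.2).mp hBW⟩
    · rintro ⟨h1, h2, h3⟩
      exact (h.arrow_iff h1 h2).mpr h3
  · intro i j hij
    exact ⟨fun B hB W hW => (hplace (Sum.inl i) (Sum.inl j) hij B hB W hW).1 rfl,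
      fun B hB W hW => (hplace (Sum.inr i) (Sum.inl j) hij W hW B hB).2 (by simp),
      fun B hB W hW => (hplace (Sum.inr i) (Sum.inr j) hij B hB W hW).1 rfl,
      fun B hB W hW => (hplace (Sum.inl i) (Sum.inr j) hij W hW B hB).2 (by simp)⟩

theorem exists_roundRep (h : 𝔹.Describes G) : ∃ Γ : RoundRep α, Γ.graph = G ∧
    Γ.IsNaturalOrdering 𝔹 := by
  have hS := h.sidedOrder
  have hmem : ∀ B W, twist 𝔹.side 𝔹.Lt B W → B ∈ G.semiblocks ∧ W ∈ G.semiblocks := by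
    rintro B W (h1 | h1)
    · exact hS.mem _ _ h1.2
    · exact (hS.mem _ _ h1.2).symm
  have hasymm : ∀ B W, twist 𝔹.side 𝔹.Lt B W → ¬ twist 𝔹.side 𝔹.Lt W B := by
    have := hS.asymm
    unfold twist
    grind
  obtain ⟨Γ, hΓ, harr⟩ := RoundRep.exists_roundRep 𝔹.concat
    (fun B hB => G.nonempty B (h.mem_concat_iff.mp hB)) h.concat_nodup
    (fun B hB W hW hne => G.disjoint (h.mem_concat_iff.mp hB) (h.mem_concat_iff.mp hW) hne)
    (twist 𝔹.side 𝔹.Lt)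
    (fun B W hBW => ⟨h.mem_concat_iff.mpr (hmem _ _ hBW).1, h.mem_concat_iff.mpr (hmem _ _ hBW).2⟩)
    hasymm (fun i j k hi hj hk hc => hS.twist_between h.concat_sorted hi hj hk hc)
  have hg : Γ.graph = G := by
    refine Γ.graph_eq_of_arrow hS.toIncOrder ?_ harr
    ext B
    rw [← Γ.mem_order, hΓ, h.mem_concat_iff]
  exact ⟨Γ, hg, isNaturalOrdering (hg ▸ h) (hΓ ▸ .refl _) harr⟩

end Describes

end CoContigOrdering

/-! ### Natural orderings describe the represented graph. -/

namespace RoundRep.IsNaturalOrdering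

open CoContigOrdering

variable {α : Type*} {Φ : RoundRep α} {𝔹 : CoContigOrdering α}

theorem nodup_unique (h : Φ.IsNaturalOrdering 𝔹) :
    (∀ p, (𝔹.X p).Nodup) ∧ ∀ p q B, B ∈ 𝔹.X p → B ∈ 𝔹.X q → p = q :=
  concat_nodup_iff.mp (h.concat.nodup_iff.mpr Φ.order_nodup)

theorem mem_semiblocks_iff (h : Φ.IsNaturalOrdering 𝔹) {B : Set α} :
    B ∈ Φ.graph.semiblocks ↔ ∃ p, B ∈ 𝔹.X p := by
  rw [← mem_concat, h.concat.mem_iff, Φ.mem_order]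

theorem not_coAdj (h : Φ.IsNaturalOrdering 𝔹) {p : Fin 𝔹.s ⊕ Fin 𝔹.s} {B W : Set α}
    (hB : B ∈ 𝔹.X p) (hW : W ∈ 𝔹.X p) : ¬ Φ.graph.CoAdj B W := by
  intro hBW
  have hc : Φ.graph.IsCliqueFamily {B | B ∈ 𝔹.X p} := by
    rcases p with p | p
    · exact (h.pair p).left_clique
    · exact (h.pair p).right_clique
  exact hBW.2.2.2 (hc hB hW hBW.2.2.1)

theorem proper (h : Φ.IsNaturalOrdering 𝔹) (B W : Set α) (hBW : Φ.graph.CoAdj B W) :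
    𝔹.side B ≠ 𝔹.side W := by
  have hu := h.nodup_unique.2
  obtain ⟨p, hB⟩ := h.mem_semiblocks_iff.mp hBW.1
  have hBs : B ∈ 𝔹.support (coContigIndex p) := mem_support.mpr ⟨p, rfl, hB⟩
  obtain ⟨q, hq, hW⟩ := mem_support.mp (mem_of_isCoComponent (h.pair _).coComponent hBW hBs)
  rw [side_eq hu hB, side_eq hu hW, ne_eq, ← eq_iff_isLeft_eq hq.symm]
  rintro rfl
  exact h.not_coAdj hB hW hBW

theorem localLt_iff (h : Φ.IsNaturalOrdering 𝔹) {i : Fin 𝔹.s} {B W : Set α} :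
    𝔹.localLt i B W ↔
      B ∈ 𝔹.support i ∧ W ∈ 𝔹.support i ∧ twist 𝔹.side Φ.Arrow B W := by
  rw [CoContigOrdering.localLt_iff h.nodup_unique.2]
  refine and_congr_right fun hB => and_congr_right fun hW => ?_
  have h1 := h.induced i B W
  have h2 := h.induced i W B
  change B ∈ _ ∨ B ∈ _ at hB
  change W ∈ _ ∨ W ∈ _ at hW
  simp only [hB, hW, true_and] at h1 h2
  rw [twist, twist, h1, h2]

/-- Semiblocks of one range are adjacent. An arrow from a later to an earlier one would pass over
everything outside the range, including a non-neighbor `E` of the earlier one. Such an `E` exists by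
connectedness of the co-component and lies outside because the range is a clique. -/
theorem range_sorted (h : Φ.IsNaturalOrdering 𝔹) (p : Fin 𝔹.s ⊕ Fin 𝔹.s) :
    (𝔹.X p).Pairwise Φ.Arrow := by
  have hnd := h.nodup_unique.1 p
  obtain ⟨L₁, L₂, hL⟩ := concat_split p
  rw [List.pairwise_iff_getElem]
  intro i j hi hj hij
  have hB : (𝔹.X p)[i] ∈ 𝔹.X p := List.getElem_mem _
  have hW : (𝔹.X p)[j] ∈ 𝔹.X p := List.getElem_mem _
  have hne : (𝔹.X p)[i] ≠ (𝔹.X p)[j] := fun e => hij.ne (hnd.getElem_inj_iff.mp e)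
  have hBs : (𝔹.X p)[i] ∈ 𝔹.support (coContigIndex p) := mem_support.mpr ⟨p, rfl, hB⟩
  have hWs : (𝔹.X p)[j] ∈ 𝔹.support (coContigIndex p) := mem_support.mpr ⟨p, rfl, hW⟩
  have hpath := path_of_isCoComponent (h.pair (coContigIndex p)).coComponent hBs hWs
  obtain ⟨E, hE⟩ : ∃ E, Φ.graph.CoAdj (𝔹.X p)[i] E := by
    rcases Relation.ReflTransGen.cases_head hpath with e | ⟨E, hE, _⟩
    · exact absurd e hne
    · exact ⟨E, hE⟩
  have hadj : Φ.Arrow (𝔹.X p)[i] (𝔹.X p)[j] ∨ Φ.Arrow (𝔹.X p)[j] (𝔹.X p)[i] := by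
    rw [← Φ.graph_adj, Φ.graph.adj_iff]
    exact ⟨h.mem_semiblocks_iff.mpr ⟨p, hB⟩, h.mem_semiblocks_iff.mpr ⟨p, hW⟩, hne,
      h.not_coAdj hB hW⟩
  refine hadj.resolve_right fun hji => ?_
  have hEc : E ∈ 𝔹.concat := by
    rw [h.concat.mem_iff, Φ.mem_order]
    exact hE.2.1
  obtain ⟨m, hm, rfl⟩ := List.getElem_of_mem hEc
  have hlen : 𝔹.concat.length = L₁.length + (𝔹.X p).length + L₂.length := by
    simp [hL, add_assoc]
  have hget : ∀ i (hi : i < (𝔹.X p).length),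
      𝔹.concat[L₁.length + i]'(by omega) = (𝔹.X p)[i] := by
    intro i hi
    simp [hL, hi]
  have hout : m < L₁.length ∨ L₁.length + (𝔹.X p).length ≤ m := by
    by_contra hcon
    push Not at hcon
    have h1 := hget (m - L₁.length) (by omega)
    have h2 : L₁.length + (m - L₁.length) = m := by omega
    simp only [h2] at h1
    rw [h1] at hE
    exact h.not_coAdj hB (List.getElem_mem _) hE
  rw [← hget i hi, ← hget j hj] at hji
  have hcy : CycLt (L₁.length + j) m (L₁.length + i) := by
    unfold CycLt
    omega
  have h1 := (Φ.arrow_between h.concat _ _ hm hcy hji).2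
  rw [hget i hi] at h1
  exact (Φ.coAdj_iff.mp hE).2.2.2.2 h1

/-- The local orders are restrictions of the twist to co-components, where transitivity holds for
any proper colouring. -/
theorem describes (h : Φ.IsNaturalOrdering 𝔹) : 𝔹.Describes Φ.graph := by
  have hu := h.nodup_unique.2
  have hI := Φ.roundRel.incOrder_twist h.proper
  have hl : ∀ i, 𝔹.localLt i = fun B W => B ∈ 𝔹.support i ∧ W ∈ 𝔹.support i ∧
      twist 𝔹.side Φ.Arrow B W := by
    intro i
    funext B W
    exact propext h.localLt_iff
  refine ⟨h.nodup_unique.1, hu, fun B => h.mem_semiblocks_iff, fun i => (h.pair i).coComponent,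
    fun p B W hB hW => h.not_coAdj hB hW, fun i B W hBW => ?_, fun i => ?_, fun i B W V h1 h2 => ?_,
    fun p => ?_⟩
  · have := (h.induced i B W).mp hBW
    exact ⟨this.1, this.2.1⟩
  · rw [hl]
    refine hI.restrict (fun B hB => ?_) fun B W => mem_of_isCoComponent (h.pair i).coComponent
    obtain ⟨p, _, hp⟩ := mem_support.mp hB
    exact h.mem_semiblocks_iff.mpr ⟨p, hp⟩
  · rw [h.localLt_iff] at h1 h2 ⊢
    exact ⟨h1.1, h2.2.1, Φ.roundRel.twist_trans_of_path h.proper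
      (path_of_isCoComponent (h.pair i).coComponent h1.1 h1.2.1) h1.2.2 h2.2.2⟩
  · refine (h.range_sorted p).imp_of_mem fun {B W} hB hW hBW => ?_
    rw [h.induced]
    have hs : ∀ {B}, B ∈ 𝔹.X p → B ∈ 𝔹.support (coContigIndex p) :=
      fun {B} hB => mem_support.mpr ⟨p, rfl, hB⟩
    exact ⟨hs hB, hs hW, hBW⟩

theorem place_twist (h : Φ.IsNaturalOrdering 𝔹) {i j : Fin 𝔹.s} (hij : i < j) {B W : Set α}
    (hB : B ∈ 𝔹.support i) (hW : W ∈ 𝔹.support j) : twist 𝔹.side Φ.Arrow B W := by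
  have hu := h.nodup_unique.2
  obtain ⟨h1, h2, h3, h4⟩ := h.place i j hij
  rcases hB with hB | hB <;> rcases hW with hW | hW <;>
    rw [twist, side_eq hu hB, side_eq hu hW]
  · exact Or.inl ⟨rfl, h1 B hB W hW⟩
  · exact Or.inr ⟨by simp, h4 W hW B hB⟩
  · exact Or.inr ⟨by simp, h2 W hW B hB⟩
  · exact Or.inl ⟨rfl, h3 B hB W hW⟩

/-- Inside a co-contig this is `induced`; between co-contigs it is `place`, whose four arrows say in
twisted form that an earlier co-contig precedes a later one. -/
theorem arrow_iff (h : Φ.IsNaturalOrdering 𝔹) (B W : Set α) :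
    Φ.Arrow B W ↔ twist 𝔹.side 𝔹.Lt B W := by
  have hu := h.nodup_unique.2
  have hI := Φ.roundRel.incOrder_twist h.proper
  suffices key : ∀ B W, 𝔹.Lt B W ↔ twist 𝔹.side Φ.Arrow B W by
    have : 𝔹.Lt = twist 𝔹.side Φ.Arrow := by
      funext B W
      exact propext (key B W)
    rw [this, twist_twist]
  intro B W
  constructor
  · rintro ⟨i, j, hB, hW, h1 | ⟨rfl, h1⟩⟩
    · exact h.place_twist h1 hB hW
    · exact (h.localLt_iff.mp h1).2.2
  · intro hBW
    obtain ⟨i, hi⟩ := h.describes.mem_semiblocks_iff.mp (hI.mem _ _ hBW).1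
    obtain ⟨j, hj⟩ := h.describes.mem_semiblocks_iff.mp (hI.mem _ _ hBW).2
    rcases lt_trichotomy i j with hij | rfl | hij
    · exact ⟨i, j, hi, hj, Or.inl hij⟩
    · exact ⟨i, i, hi, hj, Or.inr ⟨rfl, h.localLt_iff.mpr ⟨hi, hj, hBW⟩⟩⟩
    · exact (hI.asymm _ _ hBW (h.place_twist hij hj hi)).elim

end RoundRep.IsNaturalOrdering

/-! ### Invariance under natural permutations. -/

namespace CoContigOrdering

variable {α : Type*} {𝔹 : CoContigOrdering α} {w : Equiv.Perm (Fin 𝔹.s ⊕ Fin 𝔹.s)}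
  {y : Fin 𝔹.s ⊕ Fin 𝔹.s → Bool}

theorem mem_reorder {p : Fin 𝔹.s ⊕ Fin 𝔹.s} {B : Set α} :
    B ∈ (𝔹.reorder w y).X p ↔ B ∈ 𝔹.X (w p) := by
  simp only [reorder, revList]
  split_ifs <;> simp

theorem index_swap {s : ℕ} (p : Fin s ⊕ Fin s) : coContigIndex p.swap = coContigIndex p := by
  rcases p with p | p <;> rfl

theorem index_reorder (hw : ∀ i, w (Sum.inr i) = (w (Sum.inl i)).swap) (p : Fin 𝔹.s ⊕ Fin 𝔹.s) :
    coContigIndex (w p) = coContigIndex (w (Sum.inl (coContigIndex p))) := by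
  rcases p with p | p
  · rfl
  · rw [hw, index_swap]
    rfl

theorem support_reorder (hw : ∀ i, w (Sum.inr i) = (w (Sum.inl i)).swap) (i : Fin 𝔹.s) :
    (𝔹.reorder w y).support i = 𝔹.support (coContigIndex (w (Sum.inl i))) := by
  have h1 : ∀ p : Fin 𝔹.s ⊕ Fin 𝔹.s, ∀ B : Set α, (B ∈ 𝔹.X p ∨ B ∈ 𝔹.X p.swap) ↔
      B ∈ 𝔹.support (coContigIndex p) := by
    rintro (p | p) B
    · exact Iff.rfl
    · exact or_comm
  ext B
  rw [← h1, ← hw, ← mem_reorder (w := w) (y := y), ← mem_reorder (w := w) (y := y)]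
  rfl

theorem index_eq_iff (hw : ∀ i, w (Sum.inr i) = (w (Sum.inl i)).swap) {i j : Fin 𝔹.s} :
    coContigIndex (w (Sum.inl i)) = coContigIndex (w (Sum.inl j)) ↔ i = j := by
  refine ⟨fun h => ?_, fun h => by rw [h]⟩
  have h1 : w (Sum.inl i) = w (Sum.inl j) ∨ w (Sum.inl i) = w (Sum.inr j) := by
    rw [hw]
    generalize w (Sum.inl i) = p at h
    generalize w (Sum.inl j) = q at h
    rcases p with a | a <;> rcases q with b | b <;> simp_all [coContigIndex]
  rcases h1 with h1 | h1
  · exact Sum.inl_injective (w.injective h1)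
  · exact absurd (w.injective h1) Sum.inl_ne_inr

/-- `localLt` only asks whether two semiblocks share a range, so exchanging the two ranges of a
co-contig is invisible to it and only `y` acts. -/
theorem localLt_reorder (hw : ∀ i, w (Sum.inr i) = (w (Sum.inl i)).swap) (i : Fin 𝔹.s)
    (B W : Set α) : (𝔹.reorder w y).localLt i B W ↔
      revArrow (y (Sum.inl i)) (𝔹.localLt (coContigIndex (w (Sum.inl i)))) B W := by
  have key : (𝔹.reorder w y).localLt i B W ↔ ∃ p q,
      coContigIndex p = coContigIndex (w (Sum.inl i)) ∧
      coContigIndex q = coContigIndex (w (Sum.inl i)) ∧ B ∈ 𝔹.X p ∧ W ∈ 𝔹.X q ∧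
      ((p = q ∧ (𝔹.reorder w y).arrow i B W) ∨ (p ≠ q ∧ (𝔹.reorder w y).arrow i W B)) := by
    constructor
    · rintro ⟨p, q, hp, hq, hB, hW, h⟩
      change Fin 𝔹.s ⊕ Fin 𝔹.s at p q
      refine ⟨w p, w q, ?_, ?_, mem_reorder.mp hB, mem_reorder.mp hW, ?_⟩
      · rw [index_reorder hw p]
        exact congrArg (fun i => coContigIndex (w (Sum.inl i))) hp
      · rw [index_reorder hw q]
        exact congrArg (fun i => coContigIndex (w (Sum.inl i))) hq
      · rwa [ne_eq, w.injective.eq_iff]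
    · rintro ⟨p, q, hp, hq, hB, hW, h⟩
      obtain ⟨p, rfl⟩ := w.surjective p
      obtain ⟨q, rfl⟩ := w.surjective q
      rw [index_reorder hw, index_eq_iff hw] at hp hq
      rw [ne_eq, w.injective.eq_iff] at h
      exact ⟨p, q, hp, hq, mem_reorder.mpr hB, mem_reorder.mpr hW, h⟩
  rw [key]
  have e : (𝔹.reorder w y).arrow i =
    revArrow (y (Sum.inl i)) (𝔹.arrow (coContigIndex (w (Sum.inl i)))) := rfl
  rw [e]
  cases y (Sum.inl i)
  · rfl
  · simp only [revArrow, if_true]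
    constructor
    · rintro ⟨p, q, hp, hq, hB, hW, h⟩
      exact ⟨q, p, hq, hp, hW, hB, by rwa [eq_comm, ne_comm]⟩
    · rintro ⟨p, q, hp, hq, hB, hW, h⟩
      exact ⟨q, p, hq, hp, hW, hB, by rwa [eq_comm, ne_comm]⟩

/-- Each condition is insensitive to the order of the pairs and to the exchange of their ranges;
reversing a co-contig flips its local order together with both lists. -/
theorem Describes.reorder {G : SemiblockGraph α} (h : 𝔹.Describes G)
    (hw : ∀ i, w (Sum.inr i) = (w (Sum.inl i)).swap)
    (hy : ∀ i, y (Sum.inr i) = y (Sum.inl i)) : (𝔹.reorder w y).Describes G := by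
  have hl : ∀ i : Fin 𝔹.s, (𝔹.reorder w y).localLt i =
      revArrow (y (Sum.inl i)) (𝔹.localLt (coContigIndex (w (Sum.inl i)))) := by
    intro i
    funext B W
    exact propext (localLt_reorder hw i B W)
  have hyi : ∀ p, y (Sum.inl (coContigIndex p)) = y p := by
    rintro (p | p)
    · rfl
    · exact (hy p).symm
  refine ⟨fun p => ?_, fun p q B hp hq => ?_, fun B => ?_, fun (i : Fin 𝔹.s) => ?_,
    fun p B W hB hW => ?_, fun (i : Fin 𝔹.s) B W hBW => ?_, fun (i : Fin 𝔹.s) => ?_,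
    fun (i : Fin 𝔹.s) B W V h1 h2 => ?_, fun (p : Fin 𝔹.s ⊕ Fin 𝔹.s) => ?_⟩
  · show (revList (y p) (𝔹.X (w p))).Nodup
    unfold revList
    split_ifs
    · exact List.nodup_reverse.mpr (h.nodup _)
    · exact h.nodup _
  · exact w.injective (h.unique _ _ B (mem_reorder.mp hp) (mem_reorder.mp hq))
  · rw [h.mem_iff]
    constructor
    · rintro ⟨p, hp⟩
      exact ⟨w.symm p, mem_reorder.mpr (by rwa [Equiv.apply_symm_apply])⟩
    · rintro ⟨p, hp⟩
      exact ⟨w p, mem_reorder.mp hp⟩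
  · rw [support_reorder hw]
    exact h.comp _
  · exact h.clique _ _ _ (mem_reorder.mp hB) (mem_reorder.mp hW)
  · change revArrow (y (Sum.inl i)) (𝔹.arrow (coContigIndex (w (Sum.inl i)))) B W at hBW
    rw [support_reorder hw]
    unfold revArrow at hBW
    split_ifs at hBW
    · exact (h.arrow_mem _ _ _ hBW).symm
    · exact h.arrow_mem _ _ _ hBW
  · rw [hl, support_reorder hw]
    have h1 := h.local_order (coContigIndex (w (Sum.inl i)))
    cases y (Sum.inl i)
    · exact h1
    · exact h1.flip
  · rw [hl] at h1 h2 ⊢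
    have ht := h.local_trans (coContigIndex (w (Sum.inl i)))
    cases hyi : y (Sum.inl i)
    · rw [hyi] at h1 h2
      exact ht _ _ _ h1 h2
    · rw [hyi] at h1 h2
      exact ht _ _ _ h2 h1
  · show (revList (y p) (𝔹.X (w p))).Pairwise (revArrow (y (Sum.inl (coContigIndex p)))
      (𝔹.arrow (coContigIndex (w (Sum.inl (coContigIndex p))))))
    rw [hyi, ← index_reorder hw]
    have h1 := h.sorted (w p)
    cases y p
    · exact h1
    · exact List.pairwise_reverse.mpr h1

theorem IsNaturalPermutation.describes {𝕎 : CoContigOrdering α} {G : SemiblockGraph α}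
    (h : 𝔹.IsNaturalPermutation 𝕎) (hB : 𝔹.Describes G) : 𝕎.Describes G := by
  obtain ⟨w, y, hw, hy, rfl⟩ := h
  exact hB.reorder hw hy

/-- A natural ordering determines the represented graph through its supports and relations. -/
theorem Describes.graph_eq {G : SemiblockGraph α} {Γ : RoundRep α} (h : 𝔹.Describes G)
    (hΓ : Γ.IsNaturalOrdering 𝔹) : Γ.graph = G := by
  refine Γ.graph_eq_of_arrow h.sidedOrder.toIncOrder ?_ hΓ.arrow_iff
  ext B
  rw [h.mem_iff, hΓ.mem_semiblocks_iff]

end CoContigOrdering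

/-! ### All sided orders arise from natural permutations. -/

namespace CoContigOrdering

variable {α : Type*} {𝔹 : CoContigOrdering α}

/-- There are no `H`-pairs between the two co-components, so a comparison moves along `H`-paths, in
one and then in the other. -/
theorem Describes.lt_of_support {G : SemiblockGraph α} (h : 𝔹.Describes G)
    {lt : Set α → Set α → Prop} (hI : IncOrder G.semiblocks G.CoAdj lt) {i j : Fin 𝔹.s}
    (hij : i ≠ j) {B B' W W' : Set α} (hB : B ∈ 𝔹.support i) (hB' : B' ∈ 𝔹.support i)
    (hW : W ∈ 𝔹.support j) (hW' : W' ∈ 𝔹.support j) (hlt : lt B W) : lt B' W' := by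
  have hno : ∀ B W, B ∈ 𝔹.support i → W ∈ 𝔹.support j → ¬ G.CoAdj B W := fun B W h1 h2 h3 =>
    hij (support_unique h.unique (mem_of_isCoComponent (h.comp i) h3 h1) h2)
  have h1 : B' ∈ 𝔹.support i ∧ lt B' W := by
    have hp := path_of_isCoComponent (h.comp i) hB hB'
    clear hB'
    induction hp with
    | refl => exact ⟨hB, hlt⟩
    | tail _ hbc ih =>
      have hc := mem_of_isCoComponent (h.comp i) hbc ih.1
      exact ⟨hc, (hI.left _ _ _ ih.2 hbc).resolve_right (hno _ _ hc hW)⟩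
  have hp := path_of_isCoComponent (h.comp j) hW hW'
  clear hW'
  have h2 : W' ∈ 𝔹.support j ∧ lt B' W' := by
    induction hp with
    | refl => exact ⟨hW, h1.2⟩
    | tail _ hbc ih =>
      have hc := mem_of_isCoComponent (h.comp j) hbc ih.1
      exact ⟨hc, (hI.right _ _ _ ih.2 hbc).resolve_right (hno _ _ hB' hc)⟩
  exact h2.2

/-- Every sided order of the graph described by `𝔹` agrees, up to twins, with the one of a natural
permutation of `𝔹`. -/
theorem Describes.exists_reorder {G : SemiblockGraph α} (h : 𝔹.Describes G)
    (hfin : G.semiblocks.Finite) {lt : Set α → Set α → Prop} {side : Set α → Bool}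
    (hS : SidedOrder G.semiblocks G.CoAdj lt side) :
    ∃ 𝕎, 𝔹.IsNaturalPermutation 𝕎 ∧ (∀ B ∈ G.semiblocks, 𝕎.side B = side B) ∧
      ∀ B W, ¬ Twin G.CoAdj B W → (lt B W ↔ 𝕎.Lt B W) := by
  classical
  have hI := hS.toIncOrder
  have hne : ∀ i, ∃ B, B ∈ 𝔹.support i := by
    intro i
    obtain ⟨B, _, hB⟩ := G.isCoComponent_iff.mp (h.comp i)
    exact ⟨B, hB ▸ .refl⟩
  choose rep hrep using hne
  have hsub : ∀ i, 𝔹.support i ⊆ G.semiblocks := fun i B hB =>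
    h.mem_semiblocks_iff.mpr ⟨i, hB⟩

  -- Sorting representatives by their number of predecessors arranges the co-components according to
  -- `lt`.
  let f : Fin 𝔹.s → ℕ := fun i => {B | lt B (rep i)}.ncard
  have hf : ∀ i j, lt (rep i) (rep j) → f i < f j := by
    intro i j hij
    have hs : {B | lt B (rep i)} ⊆ {B | lt B (rep j)} := fun B hB => hS.trans _ _ _ hB hij
    refine Set.ncard_lt_ncard ((Set.ssubset_iff_of_subset hs).mpr ⟨rep i, hij, hI.irrefl _⟩)
      (hfin.subset fun B hB => (hI.mem _ _ hB).1)
  let π : Equiv.Perm (Fin 𝔹.s) := Tuple.sort f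
  have hmono : Monotone (f ∘ π) := Tuple.monotone_sort f
  have hltrep : ∀ i j, i < j → lt (rep (π i)) (rep (π j)) := by
    intro i j hij
    have hne : π i ≠ π j := fun e => hij.ne (π.injective e)
    have hne' : rep (π i) ≠ rep (π j) := fun e =>
      hne (support_unique h.unique (hrep _) (e ▸ hrep (π j)))
    rcases hI.tri _ _ (hsub _ (hrep (π i))) (hsub _ (hrep (π j))) hne' with h1 | h1 | h1
    · exact h1
    · exact absurd (hf _ _ h1) (not_lt.mpr (hmono hij.le))
    · exact (hne (support_unique h.unique
        (mem_of_isCoComponent (h.comp _) h1 (hrep _)) (hrep (π j)))).elim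

  -- Two proper colourings of a connected graph agree everywhere or nowhere; `F` marks the
  -- co-components whose ranges must be exchanged.
  let F : Fin 𝔹.s → Bool := fun i => decide (side (rep i) ≠ 𝔹.side (rep i))
  have hF : ∀ i B, B ∈ 𝔹.support i → (F i = true ↔ side B ≠ 𝔹.side B) := by
    intro i B hB
    have hp := path_of_isCoComponent (h.comp i) (hrep i) hB
    clear hB
    induction hp with
    | refl => simp [F]
    | @tail b c _ hbc ih =>
      have h1 := hS.proper _ _ hbc
      have h2 := h.sidedOrder.proper _ _ hbc
      refine ih.trans ?_
      cases e1 : side b <;> cases e2 : side c <;> cases e3 : 𝔹.side b <;>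
        cases e4 : 𝔹.side c <;> simp_all
  let g : Fin 𝔹.s ⊕ Fin 𝔹.s → Fin 𝔹.s ⊕ Fin 𝔹.s := fun p =>
    if F (π (coContigIndex p)) then (Sum.map π π p).swap else Sum.map π π p
  have hgi : ∀ p, coContigIndex (g p) = π (coContigIndex p) := by
    rintro (p | p) <;> simp only [g] <;> split_ifs <;> rfl
  have hginj : Function.Injective g := by
    intro p q hpq
    have h1 : coContigIndex p = coContigIndex q := π.injective (by rw [← hgi, ← hgi, hpq])
    have h2 : Sum.map π π p = Sum.map π π q := by
      simp only [g, h1] at hpq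
      split_ifs at hpq
      · exact Sum.swap_leftInverse.injective hpq
      · exact hpq
    exact Sum.map_injective.mpr ⟨π.injective, π.injective⟩ h2
  let w : Equiv.Perm (Fin 𝔹.s ⊕ Fin 𝔹.s) :=
    Equiv.ofBijective g (Finite.injective_iff_bijective.mp hginj)
  have hwg : ∀ p, w p = g p := fun _ => rfl
  have hw : ∀ i, w (Sum.inr i) = (w (Sum.inl i)).swap := by
    intro i
    by_cases hFi : F (π i) = true <;> simp [hwg, g, coContigIndex, hFi]

  -- The bit `b` tells which alternative of `agree_or_reverse` holds on the co-component.
  have hY : ∀ j, ∃ b : Bool, ∀ B W, ¬ SameNbhd G.CoAdj B W → B ∈ 𝔹.support j →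
      W ∈ 𝔹.support j → (lt B W ↔ revArrow b (𝔹.localLt j) B W) := by
    intro j
    have hcl : ∀ B W, G.CoAdj B W → B ∈ 𝔹.support j → W ∈ 𝔹.support j :=
      fun B W => mem_of_isCoComponent (h.comp j)
    rcases (hI.restrict (hsub j) hcl).agree_or_reverse (h.local_order j) hcl hS.proper
      (fun B W => path_of_isCoComponent (h.comp j)) with h1 | h1
    · exact ⟨false, fun B W hn hB hW => by simpa [revArrow, hB, hW] using h1 B W hn⟩
    · exact ⟨true, fun B W hn hB hW => by simpa [revArrow, hB, hW] using h1 B W hn⟩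
  choose Y hY using hY
  let y : Fin 𝔹.s ⊕ Fin 𝔹.s → Bool := fun p => Y (π (coContigIndex p))
  have hnat : 𝔹.IsNaturalPermutation (𝔹.reorder w y) := ⟨w, y, hw, fun i => rfl, rfl⟩
  have hW := hnat.describes h
  have hsupp : ∀ i : Fin 𝔹.s, (𝔹.reorder w y).support i = 𝔹.support (π i) := by
    intro i
    rw [support_reorder hw, hwg, hgi]
    rfl
  refine ⟨𝔹.reorder w y, hnat, fun B hB => ?_, fun B W ht => ?_⟩
  · obtain ⟨p, hp⟩ := (hW.mem_iff B).mp hB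
    change Fin 𝔹.s ⊕ Fin 𝔹.s at p
    have h1 := mem_reorder.mp hp
    have h2 := side_eq h.unique h1
    rw [side_eq hW.unique hp]
    have h3 := hF (π (coContigIndex p)) B (mem_support.mpr ⟨w p, hgi p, h1⟩)
    rw [h2, hwg] at h3
    simp only [g] at h3
    split_ifs at h3 with h4
    · rw [h4] at h3
      rcases p with p | p
      · exact (show side B = true by simpa using h3).symm
      · exact (show side B = false by simpa using h3).symm
    · rw [Bool.not_eq_true] at h4
      rw [h4] at h3
      rcases p with p | p
      · exact (show side B = true by simpa using h3.symm).symm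
      · exact (show side B = false by simpa using h3.symm).symm
  · by_cases hBW : B ∈ G.semiblocks ∧ W ∈ G.semiblocks
    · obtain ⟨i, hi⟩ := hW.mem_semiblocks_iff.mp hBW.1
      obtain ⟨j, hj⟩ := hW.mem_semiblocks_iff.mp hBW.2
      change Fin 𝔹.s at i j
      by_cases hij : i = j
      · subst hij
        rw [lt_iff_local hW.unique hi hj, localLt_reorder hw, hwg, hgi]
        change _ ↔ revArrow (Y (π i)) (𝔹.localLt (π i)) B W
        have hi' := hi
        have hj' := hj
        rw [hsupp] at hi' hj'
        by_cases hn : SameNbhd G.CoAdj B W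
        -- Distinct elements of one co-component have co-neighbors, so equal neighborhoods would
        -- make them twins.
        · have : B = W := by
            rcases Relation.ReflTransGen.cases_head
              (path_of_isCoComponent (h.comp _) hi' hj') with e | ⟨E, hE, _⟩
            · exact e
            · exact absurd ⟨⟨E, hE⟩, hn⟩ ht
          subst this
          have h1 := (h.local_order (π i)).irrefl B
          have h2 := hI.irrefl B
          simpa [revArrow, h2] using h1
        · exact hY (π i) B W hn hi' hj'
      · rw [lt_iff_index hW.unique hi hj hij]
        rw [hsupp] at hi hj
        have hπ : π i ≠ π j := fun e => hij (π.injective e)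
        constructor
        · intro hlt
          by_contra hnlt
          have h1 := hltrep j i (lt_of_le_of_ne (not_lt.mp hnlt) (Ne.symm hij))
          exact hI.asymm _ _ hlt (h.lt_of_support hI hπ.symm (hrep _) hj (hrep _) hi h1)
        · intro hlt
          exact h.lt_of_support hI hπ (hrep _) hi (hrep _) hj (hltrep i j hlt)
    · have h1 : ¬ lt B W := fun e => hBW (hI.mem _ _ e)
      have h2 : ¬ (𝔹.reorder w y).Lt B W := fun e => hBW (hW.sidedOrder.mem _ _ e)
      simp [h1, h2]

/-- Every round representation of a co-bipartite graph described by `𝔹` is, up to equality,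
naturally ordered by a natural permutation of `𝔹`. -/
theorem Describes.exists_isNaturalOrdering {Γ : RoundRep α} (h : 𝔹.Describes Γ.graph)
    (hΓ : Γ.graph.IsCoBipartite) : ∃ Γ' : RoundRep α, Γ.Equal Γ' ∧
      ∃ 𝕎 : CoContigOrdering α, 𝔹.IsNaturalPermutation 𝕎 ∧ Γ'.IsNaturalOrdering 𝕎 := by
  obtain ⟨side, M, hMr, hS, hM⟩ := Γ.exists_sidedOrder hΓ
  obtain ⟨𝕎, hnat, hside, hagree⟩ := h.exists_reorder Γ.finite_semiblocks hS
  have hW := hnat.describes h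
  have hW' := hW.sidedOrder
  have hMmem : ∀ B ∈ M, B ∈ Γ.graph.semiblocks := fun B hB => by
    rwa [← Γ.mem_order, ← hMr.mem_iff]
  have htw : twist side Γ.Arrow = twist 𝕎.side Γ.Arrow := by
    funext B W
    by_cases hBW : B ∈ Γ.graph.semiblocks ∧ W ∈ Γ.graph.semiblocks
    · rw [twist, twist, hside B hBW.1, hside W hBW.2]
    · have h1 : ¬ Γ.Arrow B W := fun e => hBW (Γ.arrow_mem e)
      have h2 : ¬ Γ.Arrow W B := fun e => hBW (Γ.arrow_mem e).symm
      simp [twist, h1, h2]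
  rw [htw] at hagree hS hM
  have hS' : SidedOrder Γ.graph.semiblocks Γ.graph.CoAdj (twist 𝕎.side Γ.Arrow) 𝕎.side :=
    ⟨hS.toIncOrder, hS.inc_mem, hW'.proper, hS.trans⟩
  have hM' : M.Pairwise (SidedBefore 𝕎.side (twist 𝕎.side Γ.Arrow)) :=
    hM.imp_of_mem fun {B W} hB hW hBW => by
      rwa [SidedBefore, hside B (hMmem B hB), hside W (hMmem W hW)]
  have hLmem : ∀ B ∈ 𝕎.concat, B ∈ Γ.graph.semiblocks := fun B => hW.mem_concat_iff.mp
  have hMn : M.Nodup := hMr.nodup_iff.mpr Γ.order_nodup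
  have hLM : 𝕎.concat.Perm M := (List.perm_ext_iff_of_nodup hW.concat_nodup hMn).mpr fun B => by
    rw [hW.mem_concat_iff, hMr.mem_iff, Γ.mem_order]
  have hlen := hLM.length_eq
  -- Rotating `𝕎.concat` by the same `k` that takes `M` to `Γ.order` aligns positions, so that twins
  -- face each other.
  obtain ⟨k, hk⟩ := hMr
  have hord : ∀ i (hi : i < Γ.order.length), Γ.order[i] =
      M[(i + k) % M.length]'(Nat.mod_lt _ (by rw [← hk, List.length_rotate] at hi; omega)) := by
    intro i hi
    rw [List.getElem_of_eq hk.symm, List.getElem_rotate]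
  have hordlen : Γ.order.length = M.length := by rw [← hk, List.length_rotate]
  have hL' : (𝕎.concat.rotate k).Perm Γ.order :=
    (List.rotate_perm _ _).trans (hLM.trans (hk ▸ (List.rotate_perm _ _).symm))
  have hrot : ∀ i (hi : i < (𝕎.concat.rotate k).length), (𝕎.concat.rotate k)[i] =
      𝕎.concat[(i + k) % M.length]'(hlen ▸ Nat.mod_lt _ (by
        rw [List.length_rotate] at hi; omega)) := by
    intro i hi
    simp only [List.getElem_rotate, hlen]
  obtain ⟨Γ', hE, ho, ha⟩ := Γ.exists_equal _ hL' fun i hi hi' => by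
    rw [hord i hi', hrot i hi]
    exact hS'.sorted_twin Γ.finite_semiblocks hagree hLM hLmem hM' hW.concat_sorted _ _ _
  have hg := hE.graph_eq
  refine ⟨Γ', hE, 𝕎, hnat, ?_⟩
  refine Describes.isNaturalOrdering (hg.symm ▸ hW) (ho ▸ ⟨k, rfl⟩) fun B W => ?_
  by_cases hBW : B ∈ Γ.graph.semiblocks ∧ W ∈ Γ.graph.semiblocks
  · have hm : ∀ {B}, B ∈ Γ.graph.semiblocks → B ∈ 𝕎.concat.rotate k := fun {B} hB => by
      rwa [List.mem_rotate, hW.mem_concat_iff]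
    obtain ⟨i, hi, rfl⟩ := List.getElem_of_mem (hm hBW.1)
    obtain ⟨j, hj, rfl⟩ := List.getElem_of_mem (hm hBW.2)
    rw [ha i j hi hj (hL'.length_eq ▸ hi) (hL'.length_eq ▸ hj), hord, hord, hrot, hrot,
      ← twist_twist 𝕎.side Γ.Arrow]
    exact hS'.sorted_twist_iff hW' Γ.finite_semiblocks hagree hLM hLmem hM' hW.concat_sorted
      _ _ _ _
  · have h1 : ¬ Γ'.Arrow B W := fun e => hBW (hg ▸ Γ'.arrow_mem e)
    have h2 : ¬ twist 𝕎.side 𝕎.Lt B W := by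
      rintro (e | e)
      · exact hBW (hW'.mem _ _ e.2)
      · exact hBW (hW'.mem _ _ e.2).symm
    simp [h1, h2]

end CoContigOrdering

theorem mainTheorem7 {α : Type*} (Φ : RoundRep α) (hΦ : Φ.graph.IsCoBipartite)
    (𝔹 : CoContigOrdering α) (h𝔹 : Φ.IsNaturalOrdering 𝔹) :
    (∀ Γ : RoundRep α, Γ.Represents Φ.graph ↔
      ∃ Γ' : RoundRep α, Γ.Equal Γ' ∧
        ∃ 𝕎 : CoContigOrdering α, 𝔹.IsNaturalPermutation 𝕎 ∧ Γ'.IsNaturalOrdering 𝕎) ∧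
    (∀ 𝕎 : CoContigOrdering α, 𝔹.IsNaturalPermutation 𝕎 →
      ∃ Γ : RoundRep α, Γ.Represents Φ.graph ∧ Γ.IsNaturalOrdering 𝕎) := by
  have hB := h𝔹.describes
  refine ⟨fun Γ => ?_, fun 𝕎 h𝕎 => ?_⟩
  · rw [Γ.represents_iff]
    constructor
    · intro hg
      exact (hg.symm ▸ hB : 𝔹.Describes Γ.graph).exists_isNaturalOrdering (hg.symm ▸ hΦ)
    · rintro ⟨Γ', hE, 𝕎, h𝕎, hN⟩
      rw [← hE.graph_eq]
      exact (h𝕎.describes hB).graph_eq hN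
  · obtain ⟨Γ, hg, hN⟩ := (h𝕎.describes hB).exists_roundRep
    exact ⟨Γ, Γ.represents_iff.mpr hg, hN⟩
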